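/- Let $G=(V,E)$ be a finite simple graph. A set $D\subseteq E$ is an \emph{edge open packing set} of $G$ if for any two distinct edges $e_1,e_2\in D$ no edge of $E\setminus\{e_1,e_2\}$ joins an endpoint of $e_1$ to an endpoint of $e_2$; the \emph{edge open packing number} $\rho_e^o(G)$ is the maximum size of an edge open packing set of $G$. A \emph{block} of $G$ is a maximal connected subgraph of $G$ that has no cut vertex of its own, and $G$ is a \emph{block graph} if every block of $G$ is a clique. \textbf{Theorem.} The maximum edge open packing problem can be solved in polynomial time for block graphs: there are a single algorithm (a program of a random access machine with addition, subtraction, indirect addressing and conditional jumps, every instruction counting as one step) and a polynomial $T$ such that, for every $n\ge 0$ and every block graph $G$ on the vertex set $\{0,\dots,n-1\}$ (connected or not), the algorithm, given $n$ and the adjacency matrix of $G$, halts after at most $T(n)$ steps and outputs the number $\rho_e^o(G)$ together with a list of the edges of an edge open packing set of $G$ of size $\rho_e^o(G)$. -/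

import Mathlib

/-! ## Edge open packings -/

namespace EOP

variable {V : Type*}

/-- `D` is an edge open packing set of `G`: a set of edges of `G` such that, for any two distinct
edges `e₁, e₂ ∈ D`, no edge of `G` other than `e₁` and `e₂` joins an endpoint of `e₁` to an
endpoint of `e₂`. -/
def IsEdgeOpenPacking (G : SimpleGraph V) (D : Set (Sym2 V)) : Prop :=
  D ⊆ G.edgeSet ∧
    ∀ e₁ ∈ D, ∀ e₂ ∈ D, e₁ ≠ e₂ → ∀ x ∈ e₁, ∀ y ∈ e₂, s(x, y) ∈ G.edgeSet →
      s(x, y) = e₁ ∨ s(x, y) = e₂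

/-- The edge open packing number of a finite graph: the largest size of an edge open packing
set. -/
noncomputable def edgeOpenPackingNumber [Finite V] (G : SimpleGraph V) : ℕ :=
  sSup {k : ℕ | ∃ D : Finset (Sym2 V), IsEdgeOpenPacking G (D : Set (Sym2 V)) ∧ D.card = k}

/-- The edge open packing number is attained by an edge open packing set. -/
theorem exists_card_eq_edgeOpenPackingNumber [Finite V] (G : SimpleGraph V) :
    ∃ D : Finset (Sym2 V), IsEdgeOpenPacking G (D : Set (Sym2 V)) ∧
      D.card = edgeOpenPackingNumber G := by
  have := Fintype.ofFinite (Sym2 V)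
  refine Nat.sSup_mem (s := {k : ℕ | ∃ D : Finset (Sym2 V),
    IsEdgeOpenPacking G (D : Set (Sym2 V)) ∧ D.card = k}) ?_ ?_
  · exact ⟨0, ∅, by simp [IsEdgeOpenPacking], rfl⟩
  · refine ⟨Fintype.card (Sym2 V), ?_⟩
    rintro k ⟨D, -, rfl⟩
    exact Finset.card_le_univ D

/-- Every edge open packing set has at most `edgeOpenPackingNumber G` edges. -/
theorem card_le_edgeOpenPackingNumber [Finite V] (G : SimpleGraph V) (D : Finset (Sym2 V))
    (hD : IsEdgeOpenPacking G (D : Set (Sym2 V))) : D.card ≤ edgeOpenPackingNumber G := by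
  have := Fintype.ofFinite (Sym2 V)
  refine le_csSup ⟨Fintype.card (Sym2 V), ?_⟩ ⟨D, hD, rfl⟩
  rintro k ⟨D, -, rfl⟩
  exact Finset.card_le_univ D

/-! ## Block graphs -/

/-- `v` is a cut vertex of the finite graph `G`: deleting `v` increases the number of connected
components. -/
def IsCutVertex [Finite V] (G : SimpleGraph V) (v : V) : Prop :=
  Nat.card G.ConnectedComponent < Nat.card (G.induce ({v}ᶜ : Set V)).ConnectedComponent

/-- `B` is a block of `G`: a maximal connected subgraph that has no cut vertex of its own. -/
def IsBlock [Finite V] (G : SimpleGraph V) (B : G.Subgraph) : Prop :=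
  Maximal (fun H : G.Subgraph => H.Connected ∧ ∀ v : H.verts, ¬ IsCutVertex H.coe v) B

/-- `G` is a block graph: every block of `G` is a clique. -/
def IsBlockGraph [Finite V] (G : SimpleGraph V) : Prop :=
  ∀ B : G.Subgraph, IsBlock G B → G.IsClique B.verts

end EOP

/-! ## Random access machines -/

namespace RAM

/-- Instructions of a random access machine. Registers (`d`, `a`, `b`) and memory cells hold natural
numbers; memory is addressed indirectly through registers. Only addition and truncated subtraction
are available as arithmetic, so that counting every instruction as one step agrees, up to a
polynomial, with the running time of Turing machines. -/
inductive Instr : Type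
  /-- put the constant `k` into register `d` -/
  | const (d k : ℕ)
  /-- put the sum of registers `a` and `b` into register `d` -/
  | add (d a b : ℕ)
  /-- put the truncated difference of registers `a` and `b` into register `d` -/
  | sub (d a b : ℕ)
  /-- put the content of the memory cell addressed by register `a` into register `d` -/
  | load (d a : ℕ)
  /-- put register `b` into the memory cell addressed by register `a` -/
  | store (a b : ℕ)
  /-- continue at instruction number `l` -/
  | jump (l : ℕ)
  /-- continue at instruction number `l` if register `a` is zero -/
  | jumpZero (a l : ℕ)

/-- A program is a finite list of instructions, numbered from `0`. -/
abbrev Program : Type := List Instr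

/-- A configuration: program counter, registers and memory. -/
structure Config : Type where
  pc : ℕ
  reg : ℕ → ℕ
  mem : ℕ → ℕ

/-- The effect of one instruction. -/
def Instr.exec : Instr → Config → Config
  | .const d k, c => { c with pc := c.pc + 1, reg := Function.update c.reg d k }
  | .add d a b, c => { c with pc := c.pc + 1, reg := Function.update c.reg d (c.reg a + c.reg b) }
  | .sub d a b, c => { c with pc := c.pc + 1, reg := Function.update c.reg d (c.reg a - c.reg b) }
  | .load d a, c => { c with pc := c.pc + 1, reg := Function.update c.reg d (c.mem (c.reg a)) }
  | .store a b, c => { c with pc := c.pc + 1, mem := Function.update c.mem (c.reg a) (c.reg b) }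
  | .jump l, c => { c with pc := l }
  | .jumpZero a l, c => { c with pc := if c.reg a = 0 then l else c.pc + 1 }

/-- One step of the machine; `none` means that the machine has halted, the program counter pointing
outside the program. -/
def step (p : Program) (c : Config) : Option Config :=
  p[c.pc]?.map fun i => i.exec c

/-- Started in the configuration `c`, the program `p` halts after exactly `t` steps, in the
configuration `c'`. -/
def HaltsIn (p : Program) : ℕ → Config → Config → Prop
  | 0, c, c' => step p c = none ∧ c' = c
  | t + 1, c, c' => ∃ d, step p c = some d ∧ HaltsIn p t d c'

open Classical in
/-- The input configuration for a graph on the vertices `0, …, n - 1`: memory holds the number `n`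
in cell `0`, followed by the adjacency matrix, row by row, in cells `1, …, n * n`; all other cells
and all registers are zero. -/
noncomputable def input {n : ℕ} (G : SimpleGraph (Fin n)) : Config where
  pc := 0
  reg := fun _ => 0
  mem := fun a =>
    if a = 0 then n
    else if ∃ i j : Fin n, G.Adj i j ∧ a = 1 + n * (i : ℕ) + (j : ℕ) then 1 else 0

/-- The memory of `c` starts with the list of numbers `w`. -/
def Outputs (c : Config) (w : List ℕ) : Prop :=
  ∀ (k : ℕ) (hk : k < w.length), c.mem k = w[k]

end RAM

/-! ## Block graphs: vertices to eliminate -/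

namespace EOP

open SimpleGraph

/-! An edge open packing is the edge set of an induced star forest. Each of its edges has an
endpoint that lies on no other of its edges. Calling one such endpoint per edge a leaf, and the
other covered vertices centers, turns the problem into maximizing the number of leaves over
labelings of the vertices (`attains_leafWeight_iff`).

In a block graph, two neighbours of `v` joined by a path avoiding `v` lie with `v` on a cycle, hence
in one block, hence are adjacent. Choosing an edge `pq` for which the component of `q` after removal
of `p` is smallest shows that every nonempty vertex set induces a graph with an isolated vertex, a
vertex of degree one, or a pair of true twins (`IsBlockGraph.exists_eliminable`). Such a vertex `u`
can be deleted once its contribution is moved to a constant or into the weights of the labels at its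
neighbour or twin `w` (`attains_isolated`, `attains_pendant`, `attains_twin`). This is what the
fourth label is for: if `w` was a leaf with center `u`, or if the twins were a leaf and its center,
the vertex that stays is used but tolerates no used neighbour. When all vertices are gone, the
constant is the optimum.

The same computation works for packings that cover only vertices of a prescribed set. This yields an
actual packing: vertices are discarded as long as the optimum persists. An optimal packing inside
the final set must cover all of it, and a packing contains every edge of the graph between covered
vertices, so the edges inside the set are the packing (`HasPacking.exists_of_critical`).

For the running time, the algorithm is written in a language whose only loops run `n` times. It is
translated in two stages, each justified by a simulation (`Imp.Stmt.compile_run`,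
`RAM.Cmd.steps_code`), and the polynomial bound is read off the syntax. -/

/-- Deleting a vertex from a cycle leaves a connected graph. -/
theorem preconnected_induce_compl_of_isCycle {V : Type*} {G : SimpleGraph V} {v : V}
    {c : G.Walk v v} (hc : c.IsCycle) (w : c.toSubgraph.verts) :
    (c.toSubgraph.coe.induce ({w}ᶜ : Set c.toSubgraph.verts)).Preconnected := by
  classical
  obtain ⟨w, hw⟩ := w
  have hw' : w ∈ c.support := (c.mem_verts_toSubgraph).1 hw
  -- Once the cycle starts at the deleted vertex, cutting off its first and last step leaves a path
  -- through all other vertices, which connects them.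
  set d := c.rotate w hw' with hd
  have hdc : d.IsCycle := hc.rotate hw'
  have hsub : d.toSubgraph = c.toSubgraph := c.toSubgraph_rotate hw'
  have hmem : ∀ x, x ∈ d.support ↔ x ∈ c.toSubgraph.verts := fun x => by
    rw [← hsub, Walk.mem_verts_toSubgraph]
  have hnil : ¬ d.Nil := hdc.not_nil
  have htail : ¬ d.tail.Nil := by
    intro h
    have h3 := hdc.three_le_length
    have := Walk.length_tail_add_one hnil
    have := Walk.length_eq_zero_iff.2 h
    omega
  set q := d.tail.dropLast with hq
  have hs1 : d.support = w :: d.tail.support := (Walk.cons_support_tail hnil).symm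
  have hs2 : d.tail.support = q.support ++ [w] := by
    have h := Walk.support_dropLast_concat htail
    simpa using h.symm
  have hnd : d.tail.support.Nodup := hdc.isPath_tail.support_nodup
  have hwq : w ∉ q.support := by
    rw [hs2] at hnd
    intro h
    exact (List.nodup_append.1 hnd).2.2 w h w (by simp) rfl
  have hqd : ∀ x, x ∈ q.support ↔ x ∈ d.support ∧ x ≠ w := by
    intro x
    rw [hs1, hs2]
    simp only [List.mem_cons, List.mem_append, List.not_mem_nil, or_false]
    constructor
    · intro h
      exact ⟨Or.inr (Or.inl h), fun e => hwq (e ▸ h)⟩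
    · rintro ⟨h | h | h, hx⟩ <;> tauto
  have hle : q.toSubgraph ≤ c.toSubgraph := by
    rw [← hsub]
    refine ⟨fun x hx => ?_, fun x y hxy => ?_⟩
    · rw [Walk.mem_verts_toSubgraph] at hx ⊢
      exact ((hqd x).1 hx).1
    · rw [Walk.adj_toSubgraph_iff_mem_edges] at hxy ⊢
      have h1 : d.edges = s(w, d.snd) :: d.tail.edges := by
        conv_lhs => rw [← Walk.cons_tail_eq d hnil]
        simp
      have h2 : d.tail.edges = q.edges ++ [s(d.tail.penultimate, w)] := by
        conv_lhs => rw [← Walk.concat_dropLast (Walk.adj_penultimate htail)]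
        rw [Walk.edges_concat, List.concat_eq_append]
      rw [h1, h2]
      simp [hxy]
  have hconn := q.toSubgraph_connected
  have hvq : ∀ x ∈ q.toSubgraph.verts, ∃ h : x ∈ c.toSubgraph.verts,
      (⟨x, h⟩ : c.toSubgraph.verts) ∈ ({⟨w, hw⟩}ᶜ : Set c.toSubgraph.verts) := by
    intro x hx
    refine ⟨hle.1 hx, ?_⟩
    rw [Walk.mem_verts_toSubgraph] at hx
    simp only [Set.mem_compl_iff, Set.mem_singleton_iff, Subtype.mk.injEq]
    exact ((hqd x).1 hx).2
  let f : q.toSubgraph.coe →g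
      c.toSubgraph.coe.induce ({⟨w, hw⟩}ᶜ : Set c.toSubgraph.verts) :=
    { toFun := fun x => ⟨⟨x.1, (hvq x.1 x.2).1⟩, (hvq x.1 x.2).2⟩
      map_rel' := fun {a b} hab => hle.2 hab }
  refine Preconnected.map f ?_ hconn.coe.preconnected
  rintro ⟨⟨x, hx⟩, hxw⟩
  simp only [Set.mem_compl_iff, Set.mem_singleton_iff, Subtype.mk.injEq] at hxw
  refine ⟨⟨x, ?_⟩, rfl⟩
  rw [Walk.mem_verts_toSubgraph]
  exact (hqd x).2 ⟨(hmem x).2 hx, hxw⟩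

/-- In a block graph, any two vertices on a common cycle are adjacent. -/
theorem IsBlockGraph.adj_of_isCycle {V : Type*} [Finite V] {G : SimpleGraph V}
    (hG : IsBlockGraph G) {v : V} {c : G.Walk v v} (hc : c.IsCycle) {a b : V}
    (ha : a ∈ c.support) (hb : b ∈ c.support) (hab : a ≠ b) : G.Adj a b := by
  -- Deleting a vertex leaves at most one component, so the cycle, as a graph of its own, has no cut
  -- vertex and extends to a block.
  have hP : c.toSubgraph.Connected ∧ ∀ w : c.toSubgraph.verts, ¬ IsCutVertex c.toSubgraph.coe w := by
    refine ⟨c.toSubgraph_connected, fun w hw => ?_⟩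
    have h1 := (preconnected_induce_compl_of_isCycle hc w).subsingleton_connectedComponent
    have h2 := c.toSubgraph_connected.coe.nonempty
    have h3 : 0 < Nat.card c.toSubgraph.coe.ConnectedComponent := by
      have : Nonempty c.toSubgraph.coe.ConnectedComponent :=
        h2.map c.toSubgraph.coe.connectedComponentMk
      exact Nat.card_pos
    have h4 := Finite.card_le_one_iff_subsingleton.2 h1
    unfold IsCutVertex at hw
    omega
  have : Finite G.Subgraph := by
    classical
    have := Fintype.ofFinite V
    infer_instance
  obtain ⟨B, hB, hmax⟩ := Finite.exists_le_maximal
    (p := fun H : G.Subgraph => H.Connected ∧ ∀ v : H.verts, ¬ IsCutVertex H.coe v) hP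
  exact hG B hmax (hB.1 (c.mem_verts_toSubgraph.2 ha)) (hB.1 (c.mem_verts_toSubgraph.2 hb)) hab

/-! ### Separation by a vertex, and the choice of a vertex to eliminate. -/

/-- Reachability inside the vertex set `U`, avoiding `v`. -/
def ReachAvoiding {V : Type*} (G : SimpleGraph V) (U : Finset V) (v : V) : V → V → Prop :=
  Relation.ReflTransGen fun x y => G.Adj x y ∧ (x ∈ U ∧ y ∈ U) ∧ x ≠ v ∧ y ≠ v

namespace ReachAvoiding

variable {V : Type*} {G : SimpleGraph V} {U : Finset V} {v : V}

theorem symm {a b : V} (h : ReachAvoiding G U v a b) : ReachAvoiding G U v b a := by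
  have : Std.Symm fun x y => G.Adj x y ∧ (x ∈ U ∧ y ∈ U) ∧ x ≠ v ∧ y ≠ v :=
    ⟨fun x y ⟨h, h1, h2⟩ => ⟨h.symm, h1.symm, h2.symm⟩⟩
  exact Relation.ReflTransGen.stdSymm.symm _ _ h

theorem single {a b : V} (h : G.Adj a b) (ha : a ∈ U) (hb : b ∈ U) (hav : a ≠ v) (hbv : b ≠ v) :
    ReachAvoiding G U v a b :=
  Relation.ReflTransGen.single ⟨h, ⟨ha, hb⟩, hav, hbv⟩

theorem trans {a b c : V} (h : ReachAvoiding G U v a b) (h' : ReachAvoiding G U v b c) :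
    ReachAvoiding G U v a c :=
  Relation.ReflTransGen.trans h h'

/-- The start has to differ from `v` because the relation is reflexive at `v` as well; all later
vertices avoid `v` by definition. -/
theorem exists_walk {a b : V} (h : ReachAvoiding G U v a b) (hv : a ≠ v) :
    ∃ p : G.Walk a b, v ∉ p.support := by
  induction h with
  | refl => exact ⟨Walk.nil, by simpa using hv.symm⟩
  | tail _ h ih =>
    obtain ⟨p, hp⟩ := ih
    exact ⟨p.concat h.1, by simp [Walk.support_concat, hp, h.2.2.2.symm]⟩

/-- A path avoiding `v` that starts at a vertex from which `p` is not reachable within `G - v`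
avoids `p`. -/
theorem avoid {a b p : V} (h : ReachAvoiding G U v a b) (hp : ¬ ReachAvoiding G U v a p) :
    ReachAvoiding G U p a b := by
  induction h with
  | refl => exact .refl
  | tail h1 h ih =>
    refine ih.tail ⟨h.1, h.2.1, ?_, ?_⟩
    · rintro rfl
      exact hp h1
    · rintro rfl
      exact hp (h1.tail h)

end ReachAvoiding

/-- In a block graph, two neighbours of `v` that are connected by a path avoiding `v` are
adjacent. -/
theorem IsBlockGraph.adj_of_reachAvoiding {V : Type*} [Finite V] {G : SimpleGraph V}
    (hG : IsBlockGraph G) {U : Finset V} {v a b : V} (ha : G.Adj v a) (hb : G.Adj v b)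
    (hab : a ≠ b) (h : ReachAvoiding G U v a b) : G.Adj a b := by
  classical
  obtain ⟨p, hp⟩ := h.exists_walk ha.ne'
  have hq : v ∉ p.bypass.support := fun h => hp (p.support_bypass_subset_support h)
  have hpath : (p.bypass.concat hb.symm).IsPath := by
    rw [Walk.concat_isPath_iff]
    exact ⟨p.bypass_isPath, hq⟩
  -- The path from `a` to `b` is closed up through `v`. Its only other edge at `v` is `bv`, which
  -- differs from `va` because `a ≠ b`.
  have hc : (Walk.cons ha (p.bypass.concat hb.symm)).IsCycle := by
    rw [Walk.cons_isCycle_iff]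
    refine ⟨hpath, ?_⟩
    rw [Walk.edges_concat]
    simp only [List.concat_eq_append, List.mem_append, List.mem_singleton, not_or]
    refine ⟨fun h => hq (Walk.fst_mem_support_of_mem_edges _ h), ?_⟩
    intro h
    have : a = b := by
      rcases Sym2.eq_iff.1 h with ⟨h1, h2⟩ | ⟨h1, h2⟩
      · exact absurd h1 hb.ne
      · exact h2
    exact hab this
  refine hG.adj_of_isCycle hc ?_ ?_ hab <;> simp [Walk.support_concat]

/-- Every nonempty vertex set of a block graph contains a vertex that, in the subgraph induced by
the set, is isolated, or has a single neighbour, or has a true twin. -/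
theorem IsBlockGraph.exists_eliminable {V : Type*} [Finite V] {G : SimpleGraph V}
    (hG : IsBlockGraph G) {U : Finset V} (hU : U.Nonempty) :
    ∃ u ∈ U, (∀ z ∈ U, ¬ G.Adj u z) ∨ ∃ w ∈ U, G.Adj u w ∧
      ((∀ z ∈ U, G.Adj u z → z = w) ∨
        ∀ z ∈ U, z ≠ u → z ≠ w → (G.Adj u z ↔ G.Adj w z)) := by
  classical
  by_cases hiso : ∃ u ∈ U, ∀ z ∈ U, ¬ G.Adj u z
  · obtain ⟨u, hu, h⟩ := hiso
    exact ⟨u, hu, Or.inl h⟩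
  push Not at hiso
  -- The component of the second vertex in `U` after removal of the first. Minimizing it over edges
  -- replaces the choice of a leaf block.
  let R : V × V → Finset V := fun e => U.filter fun x => ReachAvoiding G U e.1 e.2 x
  let E : Finset (V × V) := (U ×ˢ U).filter fun e => G.Adj e.1 e.2
  have hE : E.Nonempty := by
    obtain ⟨u, hu⟩ := hU
    obtain ⟨z, hz, h⟩ := hiso u hu
    exact ⟨(u, z), by simp [E, hu, hz, h]⟩
  obtain ⟨⟨p, q⟩, hpq, hmin⟩ := E.exists_min_image (fun e => (R e).card) hE
  simp only [E, Finset.mem_filter, Finset.mem_product] at hpq hmin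
  obtain ⟨⟨hp, hq⟩, hadj⟩ := hpq
  -- neighbours of `y` are adjacent to `p` whenever `(p, y)` is minimal
  have key : ∀ y ∈ U, G.Adj p y → R (p, y) = R (p, q) → ∀ x ∈ U, G.Adj y x → x ≠ p →
      G.Adj p x := by
    intro y hy hpy hR x hx hyx hxp
    by_contra hcon
    -- If `x` reached `p` around `y`, these two neighbours of `y` would be adjacent. So whatever `x`
    -- reaches around `y` is reached without `p`, and `R (y, x)` lies in `R (p, y)` but misses `y`.
    have hnr : ¬ ReachAvoiding G U y x p := by
      intro h
      exact hcon (hG.adj_of_reachAvoiding hyx hpy.symm hxp h).symm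
    have hlt : (R (y, x)).card < (R (p, q)).card := by
      rw [← hR]
      refine Finset.card_lt_card ⟨fun t ht => ?_, fun h => ?_⟩
      · simp only [R, Finset.mem_filter] at ht ⊢
        exact ⟨ht.1, (ReachAvoiding.single hyx hy hx hpy.ne' hxp).trans (ht.2.avoid hnr)⟩
      · have : y ∈ R (y, x) := h (by simp [R, hy]; exact .refl)
        simp only [R, Finset.mem_filter] at this
        obtain ⟨w, hw⟩ := this.2.exists_walk hyx.ne'
        exact hw w.end_mem_support
    exact absurd (hmin (y, x) ⟨⟨hy, hx⟩, hyx⟩) (not_le.2 hlt)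
  refine ⟨q, hq, Or.inr ?_⟩
  by_cases hx : ∃ x ∈ U, G.Adj q x ∧ x ≠ p
  · obtain ⟨x, hxU, hqx, hxp⟩ := hx
    have hpx := key q hq hadj rfl x hxU hqx hxp
    -- `x` and `q` are adjacent and differ from `p`, so they share a component. Thus `(p, x)` is
    -- minimal too, and `key` applies to `x` as well as to `q`.
    have hR : R (p, x) = R (p, q) := by
      have h := ReachAvoiding.single hqx hq hxU hadj.ne' hxp
      ext t
      simp only [R, Finset.mem_filter]
      exact and_congr_right fun _ => ⟨fun h' => h.trans h', fun h' => h.symm.trans h'⟩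
    refine ⟨x, hxU, hqx, Or.inr fun z hz hzq hzx => ⟨fun h => ?_, fun h => ?_⟩⟩
    · by_cases hzp : z = p
      · exact hzp ▸ hpx.symm
      · have hpz := key q hq hadj rfl z hz h hzp
        exact hG.adj_of_reachAvoiding hpx hpz hzx.symm
          ((ReachAvoiding.single hqx.symm hxU hq hxp hadj.ne').trans
            (.single h hq hz hadj.ne' hzp))
    · by_cases hzp : z = p
      · exact hzp ▸ hadj.symm
      · have hpz := key x hxU hpx hR z hz h hzp
        exact hG.adj_of_reachAvoiding hadj hpz hzq.symm
          ((ReachAvoiding.single hqx hq hxU hadj.ne' hxp).trans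
            (.single h hxU hz hxp hzp))
  · push Not at hx
    exact ⟨p, hp, hadj.symm, Or.inl hx⟩

end EOP

/-! ## Labelings of star forests and the elimination of vertices -/

namespace EOP

/-- The role of a vertex in a star forest: unused, leaf, center, or closed (used, and without used
neighbours). -/
inductive Label : Type
  | zero | leaf | center | closed
  deriving DecidableEq

/-- A labeling of the vertices in `U` that describes an induced star forest. -/
structure IsLabeling {V : Type*} (G : SimpleGraph V) (U : Finset V) (x : V → Label) : Prop where
  compat : ∀ u ∈ U, ∀ v ∈ U, G.Adj u v → x u = .zero ∨ x v = .zero ∨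
    (x u = .leaf ∧ x v = .center) ∨ (x u = .center ∧ x v = .leaf)
  leaf : ∀ u ∈ U, x u = .leaf → ∃ c ∈ U, G.Adj u c ∧ x c = .center ∧
    ∀ z ∈ U, G.Adj u z → x z = .center → z = c

/-- Some labeling of `U` has weight at least `m`, together with the weight `acc` obtained
before. -/
def Attains {V : Type*} (G : SimpleGraph V) (U : Finset V) (wt : Label → V → ℕ) (acc m : ℕ) :
    Prop :=
  ∃ x, IsLabeling G U x ∧ m ≤ acc + ∑ v ∈ U, wt (x v) v

section Elimination

variable {V : Type*} {G : SimpleGraph V} {U : Finset V} {wt wt' : Label → V → ℕ} {acc m : ℕ}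

theorem attains_empty : Attains G ∅ wt acc m ↔ m ≤ acc :=
  ⟨fun ⟨_, _, h⟩ => by simpa using h, fun h => ⟨fun _ => .zero, ⟨by simp, by simp⟩, by simpa using h⟩⟩

variable [DecidableEq V] {u w : V}

/-- Without neighbours `u` cannot be a leaf, while the other three labels are unrestricted; it
contributes the best of their weights independently of the rest. -/
theorem attains_isolated (hu : u ∈ U) (h : ∀ z ∈ U, ¬ G.Adj u z) :
    Attains G U wt acc m ↔ Attains G (U.erase u) wt
      (acc + max (wt .zero u) (max (wt .center u) (wt .closed u))) m := by
  have hsymm := G.adj_comm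
  constructor
  · rintro ⟨x, hx, hm⟩
    refine ⟨x, ⟨fun a ha b hb hab => hx.compat a (Finset.mem_of_mem_erase ha) b
      (Finset.mem_of_mem_erase hb) hab, fun a ha hxa => ?_⟩, ?_⟩
    · obtain ⟨c, hc, hac, hxc, hz⟩ := hx.leaf a (Finset.mem_of_mem_erase ha) hxa
      refine ⟨c, Finset.mem_erase.2 ⟨?_, hc⟩, hac, hxc,
        fun z hz' => hz z (Finset.mem_of_mem_erase hz')⟩
      rintro rfl
      exact h a (Finset.mem_of_mem_erase ha) hac.symm
    · rw [← Finset.add_sum_erase U _ hu] at hm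
      have : x u ≠ .leaf := fun hl => by
        obtain ⟨c, hc, hac, -⟩ := hx.leaf u hu hl
        exact h c hc hac
      cases hxu : x u <;> simp_all <;> omega
  · rintro ⟨x, hx, hm⟩
    obtain ⟨l, hl, hlm⟩ : ∃ l, l ≠ Label.leaf ∧
        max (wt .zero u) (max (wt .center u) (wt .closed u)) ≤ wt l u := by
      rcases max_choice (wt .center u) (wt .closed u) with h1 | h1 <;>
      rcases max_choice (wt .zero u) (max (wt .center u) (wt .closed u)) with h2 | h2
      · exact ⟨.zero, by simp, h2.le⟩
      · exact ⟨.center, by simp, (h2.trans h1).le⟩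
      · exact ⟨.zero, by simp, h2.le⟩
      · exact ⟨.closed, by simp, (h2.trans h1).le⟩
    have hc := hx.compat
    have hlf := hx.leaf
    refine ⟨fun v => if v = u then l else x v, ⟨?_, ?_⟩, ?_⟩
    · intro a ha b hb hab
      grind
    · intro a ha hxa
      have hau : a ≠ u := by grind
      obtain ⟨c, hc, hac, hxc, hz⟩ := hlf a (by grind) (by grind)
      exact ⟨c, by grind, hac, by grind, by grind⟩
    · rw [← Finset.add_sum_erase U _ hu]
      have : ∑ v ∈ U.erase u, wt ((fun v => if v = u then l else x v) v) v =
          ∑ v ∈ U.erase u, wt (x v) v :=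
        Finset.sum_congr rfl fun v hv => by simp [Finset.ne_of_mem_erase hv]
      rw [this]
      simp only [if_true]
      omega

/-- The vertices other than `u` and `w` contribute the same amount `r` to both sums, so that
comparing totals comes down to comparing the contributions of `u` and `w`. -/
theorem sum_eq_of_eqOn {x y : V → Label} (hu : u ∈ U) (hw : w ∈ U) (huw : u ≠ w)
    (hwt : ∀ l v, v ≠ w → wt' l v = wt l v) (hxy : ∀ v, v ≠ u → v ≠ w → y v = x v) :
    ∃ r, ∑ v ∈ U, wt (x v) v = wt (x u) u + wt (x w) w + r ∧
      ∑ v ∈ U.erase u, wt' (y v) v = wt' (y w) w + r := by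
  refine ⟨∑ v ∈ (U.erase u).erase w, wt (x v) v, ?_, ?_⟩
  · rw [← Finset.add_sum_erase U _ hu,
      ← Finset.add_sum_erase _ _ (Finset.mem_erase.2 ⟨huw.symm, hw⟩), add_assoc]
  · rw [← Finset.add_sum_erase _ _ (Finset.mem_erase.2 ⟨huw.symm, hw⟩)]
    congr 1
    refine Finset.sum_congr rfl fun v hv => ?_
    simp only [Finset.mem_erase] at hv
    rw [hwt _ _ hv.1, hxy v hv.2.1 hv.1]

/-- To compare two weighted sets that differ in the vertices `u` and `w` only, it suffices to
translate labelings, changing only the labels of `u` and `w`. -/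
theorem attains_erase_iff (hu : u ∈ U) (hw : w ∈ U) (huw : u ≠ w)
    (hwt : ∀ l v, v ≠ w → wt' l v = wt l v)
    (h₁ : ∀ x, IsLabeling G U x → ∃ l, wt (x u) u + wt (x w) w ≤ wt' l w ∧
      IsLabeling G (U.erase u) fun v => if v = w then l else x v)
    (h₂ : ∀ x, IsLabeling G (U.erase u) x → ∃ k l, wt' (x w) w ≤ wt k u + wt l w ∧
      IsLabeling G U fun v => if v = u then k else if v = w then l else x v) :
    Attains G U wt acc m ↔ Attains G (U.erase u) wt' acc m := by
  constructor
  · rintro ⟨x, hx, hm⟩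
    obtain ⟨l, hl, hy⟩ := h₁ x hx
    refine ⟨_, hy, ?_⟩
    obtain ⟨r, h1, h2⟩ := sum_eq_of_eqOn (y := fun v => if v = w then l else x v) hu hw huw hwt
      (fun v _ hv => if_neg hv)
    simp only [if_true] at h2
    omega
  · rintro ⟨x, hx, hm⟩
    obtain ⟨k, l, hl, hy⟩ := h₂ x hx
    refine ⟨_, hy, ?_⟩
    obtain ⟨r, h1, h2⟩ := sum_eq_of_eqOn (x := fun v => if v = u then k else if v = w then l else x v)
      (y := x) hu hw huw hwt (fun v hv hv' => by simp [hv, hv'])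
    simp only [if_true, if_neg huw.symm] at h1
    omega

/-- Only a leaf `w` with center `u` needs a new label. Its used neighbours can only be centers, and
`u` is its only center, so without `u` it has no used neighbour and becomes closed. -/
theorem IsLabeling.pendant_erase {x : V → Label} (hx : IsLabeling G U x) (hu : u ∈ U) (hw : w ∈ U)
    (huw : G.Adj u w) (h : ∀ z ∈ U, G.Adj u z → z = w) :
    IsLabeling G (U.erase u)
      fun v => if v = w then if x w = .leaf ∧ x u = .center then .closed else x w else x v := by
  obtain ⟨hc, hl⟩ := hx
  have hsymm := G.adj_comm
  have huw' := hc u hu w hw huw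
  have hlw := hl w hw
  refine ⟨?_, ?_⟩
  · intro a ha b hb hab
    have h1 := hc a (Finset.mem_of_mem_erase ha) b (Finset.mem_of_mem_erase hb) hab
    grind
  · intro a ha hxa
    obtain ⟨c, hc', hac, hxc, hz⟩ := hl a (Finset.mem_of_mem_erase ha) (by grind)
    -- With center `u`, the leaf `a` would be `w`, whose new label is closed.
    have hcu : c ≠ u := by grind
    refine ⟨c, Finset.mem_erase.2 ⟨hcu, hc'⟩, hac, by grind, ?_⟩
    intro z hzU haz hxz
    exact hz z (Finset.mem_of_mem_erase hzU) haz (by grind)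

/-- `hkl` lists how a label of `w` unfolds into labels of `u` and `w`. An unused `w` lets `u` be
anything but a leaf; a center `w` may take `u` as a leaf; a closed `w`, having no used neighbour,
may become a leaf with center `u`. -/
theorem IsLabeling.pendant_insert {x : V → Label} (hx : IsLabeling G (U.erase u) x) (hu : u ∈ U)
    (hw : w ∈ U) (huw : G.Adj u w) (h : ∀ z ∈ U, G.Adj u z → z = w) {k l : Label}
    (hkl : (x w = .zero ∧ l = .zero ∧ k ≠ .leaf) ∨ (k = .zero ∧ l = x w) ∨
      (x w = .center ∧ l = .center ∧ k = .leaf) ∨ (x w = .closed ∧ l = .leaf ∧ k = .center)) :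
    IsLabeling G U fun v => if v = u then k else if v = w then l else x v := by
  obtain ⟨hc, hl⟩ := hx
  have hwu := huw.ne'
  have hloop : ¬ G.Adj u u := G.irrefl
  have hcw := hc w (Finset.mem_erase.2 ⟨hwu, hw⟩)
  have hu' : ∀ z ∈ U, G.Adj z u → z = w := fun z hz hzu => h z hz hzu.symm
  refine ⟨?_, ?_⟩
  · intro a ha b hb hab
    by_cases hau : a = u
    · have hb' : b = w := h b hb (hau ▸ hab)
      subst hau hb'
      simp only [if_true, if_neg hwu]
      grind
    by_cases hbu : b = u
    · have ha' : a = w := hu' a ha (hbu ▸ hab)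
      subst hbu ha'
      simp only [if_true, if_neg hwu]
      grind
    have h1 := hc a (Finset.mem_erase.2 ⟨hau, ha⟩) b (Finset.mem_erase.2 ⟨hbu, hb⟩) hab
    simp only [if_neg hau, if_neg hbu]
    by_cases haw : a = w
    · subst haw
      have hba := hab.ne'
      simp only [if_true, if_neg hba]
      grind
    by_cases hbw : b = w
    · subst hbw
      simp only [if_true, if_neg haw]
      have := hcw a (Finset.mem_erase.2 ⟨hau, ha⟩) hab.symm
      grind
    simpa only [if_neg haw, if_neg hbw] using h1
  · intro a ha hxa
    by_cases hau : a = u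
    · subst hau
      simp only [if_true] at hxa
      exact ⟨w, hw, huw, by grind, fun z hz haz _ => h z hz haz⟩
    by_cases haw : a = w
    · subst haw
      simp only [if_neg hwu, if_true] at hxa
      by_cases hka : k = .center
      · refine ⟨u, hu, huw.symm, by simp [hka], fun z hz haz hxz => ?_⟩
        have := haz.ne'
        by_contra hzu
        have := hcw z (Finset.mem_erase.2 ⟨hzu, hz⟩) haz
        grind
      · obtain ⟨c, hc', hac, hxc, hz⟩ := hl a (Finset.mem_erase.2 ⟨hau, ha⟩) (by grind)
        refine ⟨c, Finset.mem_of_mem_erase hc', hac, ?_, fun z hzU haz hxz => ?_⟩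
        · have := hac.ne'
          simp only [if_neg (Finset.ne_of_mem_erase hc'), if_neg this, hxc]
        · have := haz.ne'
          have hzu : z ≠ u := by rintro rfl; simp [hka] at hxz
          simp only [if_neg hzu, if_neg this] at hxz
          exact hz z (Finset.mem_erase.2 ⟨hzu, hzU⟩) haz hxz
    · simp only [if_neg hau, if_neg haw] at hxa
      obtain ⟨c, hc', hac, hxc, hz⟩ := hl a (Finset.mem_erase.2 ⟨hau, ha⟩) hxa
      refine ⟨c, Finset.mem_of_mem_erase hc', hac, ?_, fun z hzU haz hxz => ?_⟩
      · simp only [if_neg (Finset.ne_of_mem_erase hc')]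
        grind
      · have hzu : z ≠ u := fun hzu => haw (hu' a ha (hzu ▸ haz))
        simp only [if_neg hzu] at hxz
        refine hz z (Finset.mem_erase.2 ⟨hzu, hzU⟩) haz ?_
        by_cases hzw : z = w
        · subst hzw
          have := hcw a (Finset.mem_erase.2 ⟨hau, ha⟩) haz.symm
          grind
        · simpa only [if_neg hzw] using hxz

/-- If both twins are used, they are a leaf and a center. A used common neighbour would have to be a
center because of the one and a leaf because of the other, so there is none and the merged vertex is
closed. If one twin is unused, the merged vertex takes the label of the other, since both have the
same neighbours. -/
theorem IsLabeling.twin_erase {x : V → Label} (hx : IsLabeling G U x) (hu : u ∈ U) (hw : w ∈ U)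
    (huw : G.Adj u w) (h : ∀ z ∈ U, z ≠ u → z ≠ w → (G.Adj u z ↔ G.Adj w z)) :
    IsLabeling G (U.erase u) fun v =>
      if v = w then if x u = .zero then x w else if x w = .zero then x u else .closed else x v := by
  obtain ⟨hc, hl⟩ := hx
  have huw' := hc u hu w hw huw
  have hwu := huw.ne'
  have hcw : ∀ z ∈ U, z ≠ u → G.Adj w z → x z = .zero ∨
      (if x u = .zero then x w else if x w = .zero then x u else .closed) = .zero ∨
      ((if x u = .zero then x w else if x w = .zero then x u else .closed) = .leaf ∧
        x z = .center) ∨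
      ((if x u = .zero then x w else if x w = .zero then x u else .closed) = .center ∧
        x z = .leaf) := by
    intro z hz hzu hwz
    have h1 := hc w hw z hz hwz
    have h2 := hc u hu z hz ((h z hz hzu hwz.ne').2 hwz)
    clear h hc hl
    generalize x u = a at *
    generalize x w = b at *
    generalize x z = c at *
    revert huw' h1 h2
    cases a <;> cases b <;> cases c <;> simp
  refine ⟨?_, ?_⟩
  · intro a ha b hb hab
    rw [Finset.mem_erase] at ha hb
    by_cases haw : a = w
    · subst haw
      have := hcw b hb.2 hb.1 hab
      simp only [if_true, if_neg hab.ne']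
      tauto
    by_cases hbw : b = w
    · subst hbw
      have := hcw a ha.2 ha.1 hab.symm
      simp only [if_true, if_neg haw]
      tauto
    simpa only [if_neg haw, if_neg hbw] using hc a ha.2 b hb.2 hab
  · intro a ha hxa
    rw [Finset.mem_erase] at ha
    by_cases haw : a = w
    · subst haw
      simp only [if_true] at hxa
      by_cases hxu : x u = .zero
      · rw [if_pos hxu] at hxa
        obtain ⟨c, hc', hac, hxc, hz⟩ := hl a hw hxa
        refine ⟨c, Finset.mem_erase.2 ⟨by grind, hc'⟩, hac, by simp [hac.ne', hxc], ?_⟩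
        intro z hzU haz hxz
        simp only [if_neg haz.ne'] at hxz
        exact hz z (Finset.mem_of_mem_erase hzU) haz hxz
      · have hxw : x a = .zero := by grind
        rw [if_neg hxu, if_pos hxw] at hxa
        obtain ⟨c, hc', hac, hxc, hz⟩ := hl u hu hxa
        have hca : c ≠ a := by grind
        refine ⟨c, Finset.mem_erase.2 ⟨hac.ne', hc'⟩, (h c hc' hac.ne' hca).1 hac,
          by simp [hca, hxc], ?_⟩
        intro z hzU haz hxz
        rw [Finset.mem_erase] at hzU
        simp only [if_neg haz.ne'] at hxz
        exact hz z hzU.2 ((h z hzU.2 hzU.1 haz.ne').2 haz) hxz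
    · simp only [if_neg haw] at hxa
      obtain ⟨c, hc', hac, hxc, hz⟩ := hl a ha.2 hxa
      have hwa : ∀ z ∈ U, z = u ∨ z = w → G.Adj a z → G.Adj a u ∧ G.Adj a w := by
        intro z hz hzz haz
        have := h a ha.2 ha.1 haw
        rcases hzz with rfl | rfl
        · exact ⟨haz, (this.1 haz.symm).symm⟩
        · exact ⟨(this.2 haz.symm).symm, haz⟩
      -- A leaf whose center is one of the twins is adjacent to both. Uniqueness of its center makes
      -- the other twin unused, so the merged vertex is a center.
      by_cases hcu : c = u ∨ c = w
      · obtain ⟨h1, h2⟩ := hwa c hc' hcu hac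
        refine ⟨w, Finset.mem_erase.2 ⟨hwu, hw⟩, h2, ?_, ?_⟩
        · have := hc a ha.2 u hu h1
          have := hc a ha.2 w hw h2
          grind
        · intro z hzU haz hxz
          rw [Finset.mem_erase] at hzU
          by_contra hzw
          simp only [if_neg hzw] at hxz
          have := hz z hzU.2 haz hxz
          grind
      · push Not at hcu
        refine ⟨c, Finset.mem_erase.2 ⟨hcu.1, hc'⟩, hac, by simp [hcu.2, hxc], ?_⟩
        intro z hzU haz hxz
        rw [Finset.mem_erase] at hzU
        by_cases hzw : z = w
        · exfalso
          obtain ⟨h1, h2⟩ := hwa z hzU.2 (Or.inr hzw) haz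
          simp only [if_pos hzw] at hxz
          have h3 := hz u hu h1
          have h4 := hz w hw h2
          grind
        · simp only [if_neg hzw] at hxz
          exact hz z hzU.2 haz hxz

-- Either twin may carry the label of `w` while the other is unused. A closed `w` may also split
-- into a leaf and its center, because none of the common neighbours is used.
set_option maxHeartbeats 1000000 in
theorem IsLabeling.twin_insert {x : V → Label} (hx : IsLabeling G (U.erase u) x) (hu : u ∈ U)
    (hw : w ∈ U) (huw : G.Adj u w) (h : ∀ z ∈ U, z ≠ u → z ≠ w → (G.Adj u z ↔ G.Adj w z))
    {k l : Label} (hkl : (k = .zero ∧ l = x w) ∨ (k = x w ∧ l = .zero) ∨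
      (x w = .closed ∧ (k = .leaf ∧ l = .center ∨ k = .center ∧ l = .leaf))) :
    IsLabeling G U fun v => if v = u then k else if v = w then l else x v := by
  obtain ⟨hc, hl⟩ := hx
  have hwu := huw.ne'
  have hcw : ∀ z ∈ U, z ≠ u → z ≠ w → G.Adj w z → (x w = .zero ∨ x z = .zero ∨
    (x w = .leaf ∧ x z = .center) ∨ (x w = .center ∧ x z = .leaf)) := fun z hz hzu hzw hwz =>
    hc w (Finset.mem_erase.2 ⟨hwu, hw⟩) z (Finset.mem_erase.2 ⟨hzu, hz⟩) hwz
  -- A used common neighbour sees at most one used twin, and that twin carries the label of `w`.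
  -- This gives compatibility as well as uniqueness of centers.
  have hkw : ∀ z ∈ U, z ≠ u → z ≠ w → G.Adj w z → (x z = .zero ∨ (k = .zero ∧ l = .zero) ∨
      (x w = .leaf ∧ x z = .center ∧ (k = .leaf ∧ l = .zero ∨ k = .zero ∧ l = .leaf)) ∨
      (x w = .center ∧ x z = .leaf ∧ (k = .center ∧ l = .zero ∨ k = .zero ∧ l = .center))) := by
    intro z hz hzu hzw hwz
    have := hcw z hz hzu hzw hwz
    clear h hc hl hcw
    grind
  have hlk : k = .zero ∨ l = .zero ∨ (k = .leaf ∧ l = .center) ∨ (k = .center ∧ l = .leaf) := by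
    tauto
  refine ⟨?_, ?_⟩
  · have one : ∀ b ∈ U, b ≠ u → b ≠ w → ∀ a, a = u ∨ a = w → G.Adj a b → ∀ j, j = k ∨ j = l →
        j = .zero ∨ x b = .zero ∨ (j = .leaf ∧ x b = .center) ∨ (j = .center ∧ x b = .leaf) := by
      intro b hb hbu hbw a ha hab j hj
      have := hkw b hb hbu hbw (by
        rcases ha with rfl | rfl
        · exact (h b hb hbu hbw).1 hab
        · exact hab)
      clear h hc hl hcw hkw
      grind
    intro a ha b hb hab
    by_cases ha' : a = u ∨ a = w
    · by_cases hb' : b = u ∨ b = w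
      · rcases ha' with rfl | rfl <;> rcases hb' with rfl | rfl
        · exact absurd rfl hab.ne
        · simpa only [if_true, if_neg hwu] using hlk
        · simp only [if_true, if_neg hwu]
          tauto
        · exact absurd rfl hab.ne
      · push Not at hb'
        have := one b hb hb'.1 hb'.2 a ha' hab
        simp only [if_neg hb'.1, if_neg hb'.2]
        refine this _ ?_
        split_ifs <;> tauto
    · push Not at ha'
      simp only [if_neg ha'.1, if_neg ha'.2]
      by_cases hb' : b = u ∨ b = w
      · have := one a ha ha'.1 ha'.2 b hb' hab.symm
          (if b = u then k else if b = w then l else x b) (by split_ifs <;> tauto)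
        rcases this with e | e | ⟨e, e'⟩ | ⟨e, e'⟩
        exacts [.inr (.inl e), .inl e, .inr (.inr (.inr ⟨e', e⟩)), .inr (.inr (.inl ⟨e', e⟩))]
      · push Not at hb'
        simp only [if_neg hb'.1, if_neg hb'.2]
        exact hc a (Finset.mem_erase.2 ⟨ha'.1, ha⟩) b (Finset.mem_erase.2 ⟨hb'.1, hb⟩) hab
  · intro a ha hxa
    by_cases ha' : a = u ∨ a = w
    · by_cases hkl' : k = .zero ∨ l = .zero
      · have hxw : x w = .leaf := by
          clear h hc hl hcw hkw
          grind
        obtain ⟨c, hc', hac, hxc, hz⟩ := hl w (Finset.mem_erase.2 ⟨hwu, hw⟩) hxw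
        rw [Finset.mem_erase] at hc'
        refine ⟨c, hc'.2, ?_, by simp [hc'.1, hac.ne', hxc], ?_⟩
        · rcases ha' with rfl | rfl
          · exact (h c hc'.2 hc'.1 hac.ne').2 hac
          · exact hac
        · intro z hzU haz hxz
          by_cases hz' : z = u ∨ z = w
          · have := haz.ne
            clear h hc hl hcw hkw hz
            grind
          push Not at hz'
          simp only [if_neg hz'.1, if_neg hz'.2] at hxz
          refine hz z (Finset.mem_erase.2 ⟨hz'.1, hzU⟩) ?_ hxz
          rcases ha' with rfl | rfl
          · exact (h z hzU hz'.1 hz'.2).1 haz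
          · exact haz
      · obtain ⟨b, hb, hab, hxb, hbb⟩ : ∃ b ∈ U, G.Adj a b ∧
            (if b = u then k else if b = w then l else x b) = Label.center ∧
            ∀ z, z = u ∨ z = w → G.Adj a z → z = b := by
          rcases ha' with rfl | rfl
          · refine ⟨w, hw, huw, ?_, ?_⟩
            · clear h hc hl hcw hkw
              grind
            · rintro z (rfl | rfl) haz
              · exact absurd rfl haz.ne
              · rfl
          · refine ⟨u, hu, huw.symm, ?_, ?_⟩
            · clear h hc hl hcw hkw
              grind
            · rintro z (rfl | rfl) haz
              · rfl
              · exact absurd rfl haz.ne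
        refine ⟨b, hb, hab, hxb, fun z hzU haz hxz => ?_⟩
        by_cases hz' : z = u ∨ z = w
        · exact hbb z hz' haz
        · push Not at hz'
          exfalso
          have := hkw z hzU hz'.1 hz'.2 (by
            rcases ha' with rfl | rfl
            · exact (h z hzU hz'.1 hz'.2).1 haz
            · exact haz)
          simp only [if_neg hz'.1, if_neg hz'.2] at hxz
          clear h hc hl hcw hkw
          grind
    · push Not at ha'
      simp only [if_neg ha'.1, if_neg ha'.2] at hxa
      obtain ⟨c, hc', hac, hxc, hz⟩ := hl a (Finset.mem_erase.2 ⟨ha'.1, ha⟩) hxa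
      rw [Finset.mem_erase] at hc'
      have hwa := h a ha ha'.1 ha'.2
      by_cases hcw' : c = w
      · subst hcw'
        have := hkw a ha ha'.1 ha'.2 hac.symm
        by_cases hlz : l = .zero
        · refine ⟨u, hu, (hwa.2 hac.symm).symm, ?_, ?_⟩
          · clear h hc hl hcw hkw hz
            grind
          · intro z hzU haz hxz
            by_contra hzu
            by_cases hzc : z = c
            · simp [hzc, hlz, hwu] at hxz
            · simp only [if_neg hzu, if_neg hzc] at hxz
              exact hzc (hz z (Finset.mem_erase.2 ⟨hzu, hzU⟩) haz hxz)
        · refine ⟨c, hw, hac, ?_, ?_⟩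
          · clear h hc hl hcw hkw hz
            grind
          · intro z hzU haz hxz
            by_contra hzc
            by_cases hzu : z = u
            · clear h hc hl hcw hkw hz
              grind
            · simp only [if_neg hzu, if_neg hzc] at hxz
              exact hzc (hz z (Finset.mem_erase.2 ⟨hzu, hzU⟩) haz hxz)
      · refine ⟨c, hc'.2, hac, by simp [hc'.1, hcw', hxc], ?_⟩
        intro z hzU haz hxz
        by_cases hz' : z = u ∨ z = w
        · exfalso
          have haw : G.Adj w a := by
            rcases hz' with rfl | rfl
            · exact hwa.1 haz.symm
            · exact haz.symm
          have h1 := hkw a ha ha'.1 ha'.2 haw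
          have h2 := hz w (Finset.mem_erase.2 ⟨hwu, hw⟩) haw.symm
          clear h hc hl hcw hkw hz
          grind
        · push Not at hz'
          simp only [if_neg hz'.1, if_neg hz'.2] at hxz
          exact hz z (Finset.mem_erase.2 ⟨hz'.1, hzU⟩) haz hxz

/-- Each new weight at `w` is the maximum of the summed weights over those pairs of labels of `u`
and `w` that `IsLabeling.pendant_erase` turns into the label in question. -/
theorem attains_pendant (hu : u ∈ U) (hw : w ∈ U) (huw : G.Adj u w)
    (h : ∀ z ∈ U, G.Adj u z → z = w) (hwt : ∀ l v, v ≠ w → wt' l v = wt l v)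
    (h_zero : wt' .zero w = wt .zero w + max (wt .zero u) (max (wt .center u) (wt .closed u)))
    (h_leaf : wt' .leaf w = wt .leaf w + wt .zero u)
    (h_center : wt' .center w = wt .center w + max (wt .zero u) (wt .leaf u))
    (h_closed : wt' .closed w =
      max (wt .closed w + wt .zero u) (wt .leaf w + wt .center u)) :
    Attains G U wt acc m ↔ Attains G (U.erase u) wt' acc m := by
  refine attains_erase_iff hu hw huw.ne hwt ?_ ?_
  · intro x hx
    refine ⟨_, ?_, hx.pendant_erase hu hw huw h⟩
    have huw' := hx.compat u hu w hw huw
    have hul : x u = .leaf → x w = .center := fun hxu => by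
      obtain ⟨c, hc, hac, hxc, -⟩ := hx.leaf u hu hxu
      exact h c hc hac ▸ hxc
    revert huw' hul
    cases x u <;> cases x w <;>
      simp <;> omega
  · intro x hx
    have main := fun k l => hx.pendant_insert hu hw huw h (k := k) (l := l)
    cases hxw : x w with
    | zero =>
      rw [h_zero]
      rcases max_choice (wt .center u) (wt .closed u) with h1 | h1 <;>
      rcases max_choice (wt .zero u) (max (wt .center u) (wt .closed u)) with h2 | h2
      · exact ⟨.zero, .zero, by omega, main _ _ (by simp [hxw])⟩
      · exact ⟨.center, .zero, by omega, main _ _ (by simp [hxw])⟩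
      · exact ⟨.zero, .zero, by omega, main _ _ (by simp [hxw])⟩
      · exact ⟨.closed, .zero, by omega, main _ _ (by simp [hxw])⟩
    | leaf => exact ⟨.zero, .leaf, by omega, main _ _ (by simp [hxw])⟩
    | center =>
      rcases max_choice (wt .zero u) (wt .leaf u) with h1 | h1
      · exact ⟨.zero, .center, by omega, main _ _ (by simp [hxw])⟩
      · exact ⟨.leaf, .center, by omega, main _ _ (by simp [hxw])⟩
    | closed =>
      rcases max_choice (wt .closed w + wt .zero u) (wt .leaf w + wt .center u) with h1 | h1
      · exact ⟨.zero, .closed, by omega, main _ _ (by simp [hxw])⟩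
      · exact ⟨.center, .leaf, by omega, main _ _ (by simp [hxw])⟩

/-- The new weights follow `IsLabeling.twin_erase` in the same way; the last two options for
`closed` are the twins that form a leaf and its center. -/
theorem attains_twin (hu : u ∈ U) (hw : w ∈ U) (huw : G.Adj u w)
    (h : ∀ z ∈ U, z ≠ u → z ≠ w → (G.Adj u z ↔ G.Adj w z))
    (hwt : ∀ l v, v ≠ w → wt' l v = wt l v)
    (h_zero : wt' .zero w = wt .zero u + wt .zero w)
    (h_leaf : wt' .leaf w = max (wt .zero u + wt .leaf w) (wt .leaf u + wt .zero w))
    (h_center : wt' .center w = max (wt .zero u + wt .center w) (wt .center u + wt .zero w))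
    (h_closed : wt' .closed w =
      max (max (wt .zero u + wt .closed w) (wt .closed u + wt .zero w))
        (max (wt .leaf u + wt .center w) (wt .center u + wt .leaf w))) :
    Attains G U wt acc m ↔ Attains G (U.erase u) wt' acc m := by
  refine attains_erase_iff hu hw huw.ne hwt ?_ ?_
  · intro x hx
    refine ⟨_, ?_, hx.twin_erase hu hw huw h⟩
    have huw' := hx.compat u hu w hw huw
    revert huw'
    cases x u <;> cases x w <;>
      simp <;> omega
  · intro x hx
    have main := fun k l => hx.twin_insert hu hw huw h (k := k) (l := l)
    cases hxw : x w with
    | zero => exact ⟨.zero, .zero, by omega, main _ _ (by simp [hxw])⟩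
    | leaf =>
      rcases max_choice (wt .zero u + wt .leaf w) (wt .leaf u + wt .zero w) with h1 | h1
      · exact ⟨.zero, .leaf, by omega, main _ _ (by simp [hxw])⟩
      · exact ⟨.leaf, .zero, by omega, main _ _ (by simp [hxw])⟩
    | center =>
      rcases max_choice (wt .zero u + wt .center w) (wt .center u + wt .zero w) with h1 | h1
      · exact ⟨.zero, .center, by omega, main _ _ (by simp [hxw])⟩
      · exact ⟨.center, .zero, by omega, main _ _ (by simp [hxw])⟩
    | closed =>
      rcases max_choice (max (wt .zero u + wt .closed w) (wt .closed u + wt .zero w))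
        (max (wt .leaf u + wt .center w) (wt .center u + wt .leaf w)) with h0 | h0
      · rcases max_choice (wt .zero u + wt .closed w) (wt .closed u + wt .zero w) with h1 | h1
        · exact ⟨.zero, .closed, by omega, main _ _ (by simp [hxw])⟩
        · exact ⟨.closed, .zero, by omega, main _ _ (by simp [hxw])⟩
      · rcases max_choice (wt .leaf u + wt .center w) (wt .center u + wt .leaf w) with h1 | h1
        · exact ⟨.leaf, .center, by omega, main _ _ (by simp [hxw])⟩
        · exact ⟨.center, .leaf, by omega, main _ _ (by simp [hxw])⟩

end Elimination

end EOP

/-! ## Edge open packings as labelings -/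

namespace EOP

/-- The weights for which the weight of a labeling is its number of leaves. -/
def leafWeight {V : Type*} (l : Label) (_ : V) : ℕ := if l = .leaf then 1 else 0

/-- Some edge open packing set with at least `m` edges covers only vertices of `W`. -/
def HasPacking {V : Type*} (G : SimpleGraph V) (W : Finset V) (m : ℕ) : Prop :=
  ∃ D : Finset (Sym2 V), IsEdgeOpenPacking G (D : Set (Sym2 V)) ∧
    (∀ e ∈ D, ∀ v ∈ e, v ∈ W) ∧ m ≤ D.card

variable {V : Type*} {G : SimpleGraph V} {W : Finset V} {m : ℕ}

theorem HasPacking.mono {W' : Finset V} (h : HasPacking G W m) (hW : W ⊆ W') :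
    HasPacking G W' m := by
  obtain ⟨D, h1, h2, h3⟩ := h
  exact ⟨D, h1, fun e he v hv => hW (h2 e he v hv), h3⟩

theorem sum_leafWeight (x : V → Label) :
    ∑ v ∈ W, leafWeight (x v) v = (W.filter fun v => x v = .leaf).card := by
  simp [leafWeight]

/-- Every edge of an edge open packing set has an endpoint that lies on no other edge of the
set. -/
theorem IsEdgeOpenPacking.exists_leaf {D : Set (Sym2 V)} (hD : IsEdgeOpenPacking G D) {e : Sym2 V}
    (he : e ∈ D) : ∃ v ∈ e, ∀ e' ∈ D, v ∈ e' → e' = e := by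
  by_contra! hcon
  induction e using Sym2.ind with
  | _ a b =>
    obtain ⟨e₁, h₁, ha, hn₁⟩ := hcon a (Sym2.mem_mk_left a b)
    obtain ⟨e₂, h₂, hb, hn₂⟩ := hcon b (Sym2.mem_mk_right a b)
    have hab : a ≠ b := (hD.1 he).ne
    have hne : e₁ ≠ e₂ := by
      rintro rfl
      exact hn₁ ((Sym2.mem_and_mem_iff hab).1 ⟨ha, hb⟩)
    rcases hD.2 e₁ h₁ e₂ h₂ hne a ha b hb (hD.1 he) with h | h
    · exact hn₁ h.symm
    · exact hn₂ h.symm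

/-- Take the edge from each leaf to its center. An edge of `G` between covered vertices joins a leaf
to a center, necessarily to the unique one of that leaf, so it is itself one of the two edges
compared. -/
theorem IsLabeling.hasPacking {x : V → Label} (hx : IsLabeling G W x) :
    HasPacking G W (W.filter fun v => x v = .leaf).card := by
  classical
  obtain ⟨hc, hl⟩ := hx
  choose! c hcW hadj hcen huniq using hl
  have inj : ∀ v ∈ W, x v = .leaf → ∀ z ∈ W, x z = .leaf → z ∈ s(v, c v) → z = v := by
    intro v hv hxv z hz hxz hzm
    rcases Sym2.mem_iff.1 hzm with h | h
    · exact h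
    · have := hcen v hv hxv
      rw [← h, hxz] at this
      cases this
  have edge : ∀ v ∈ W, x v = .leaf → ∀ z ∈ W, G.Adj v z → x z ≠ .zero → s(v, z) = s(v, c v) := by
    intro v hv hxv z hz hvz hxz
    have hxz' : x z = .center := by
      have := hc v hv z hz hvz
      simpa [hxv, hxz] using this
    rw [huniq v hv hxv z hz hvz hxz']
  have used : ∀ v ∈ W, x v = .leaf → ∀ z ∈ s(v, c v), z ∈ W ∧ (z = v ∨ x z = .center) := by
    intro v hv hxv z hz
    rcases Sym2.mem_iff.1 hz with rfl | rfl
    · exact ⟨hv, Or.inl rfl⟩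
    · exact ⟨hcW v hv hxv, Or.inr (hcen v hv hxv)⟩
  refine ⟨(W.filter fun v => x v = .leaf).image fun v => s(v, c v), ⟨?_, ?_⟩, ?_, ?_⟩
  · intro e he
    simp only [Finset.coe_image, Set.mem_image, Finset.mem_coe, Finset.mem_filter] at he
    obtain ⟨v, ⟨hv, hxv⟩, rfl⟩ := he
    exact hadj v hv hxv
  · simp only [Finset.coe_image, Set.mem_image, Finset.mem_coe, Finset.mem_filter]
    rintro _ ⟨v, ⟨hv, hxv⟩, rfl⟩ _ ⟨w, ⟨hw, hxw⟩, rfl⟩ hne y hy z hz hyz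
    obtain ⟨hyW, hy'⟩ := used v hv hxv y hy
    obtain ⟨hzW, hz'⟩ := used w hw hxw z hz
    have hy0 : x y ≠ .zero := by rcases hy' with h | h <;> simp [h, hxv]
    have hz0 : x z ≠ .zero := by rcases hz' with h | h <;> simp [h, hxw]
    rcases hy' with rfl | hy'
    · exact Or.inl (edge y hv hxv z hzW hyz hz0)
    rcases hz' with rfl | hz'
    · right
      rw [Sym2.eq_swap]
      exact edge z hw hxw y hyW hyz.symm hy0
    · have := hc y hyW z hzW hyz
      simp [hy', hz'] at this
  · simp only [Finset.mem_image, Finset.mem_filter]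
    rintro _ ⟨v, ⟨hv, hxv⟩, rfl⟩ z hz
    exact (used v hv hxv z hz).1
  · refine (Finset.card_image_of_injOn ?_).ge
    intro v hv w hw h
    simp only [Finset.coe_filter, Set.mem_ofPred_eq] at hv hw
    refine (inj v hv.1 hv.2 w hw.1 hw.2 ?_).symm
    have : s(v, c v) = s(w, c w) := h
    rw [this]
    exact Sym2.mem_mk_left _ _

/-- Each edge selects one endpoint that lies on no other edge of `D` as its leaf; the other covered
vertices become centers. For an edge that shares no endpoint with another, the selection breaks the
tie, so it counts once. -/
theorem IsEdgeOpenPacking.exists_isLabeling {D : Finset (Sym2 V)}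
    (hD : IsEdgeOpenPacking G (D : Set (Sym2 V))) (hW : ∀ e ∈ D, ∀ v ∈ e, v ∈ W) :
    ∃ x, IsLabeling G W x ∧ D.card = (W.filter fun v => x v = .leaf).card := by
  classical
  rcases D.eq_empty_or_nonempty with rfl | ⟨e₀, -⟩
  · exact ⟨fun _ => .zero, ⟨by simp, by simp⟩, by simp⟩
  -- `choose!` needs a default vertex, which is why the empty packing is treated apart.
  have : Nonempty V := ⟨e₀.out.1⟩
  have hleaf : ∀ e ∈ D, ∃ v ∈ e, ∀ e' ∈ D, v ∈ e' → e' = e := fun e he => hD.exists_leaf he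
  choose! l hle huniq using hleaf
  obtain ⟨hE, hP⟩ := hD
  let L : V → Prop := fun v => ∃ e ∈ D, l e = v
  let C : V → Prop := fun v => ∃ e ∈ D, v ∈ e
  -- edges of `G` between covered vertices belong to `D`
  have key : ∀ a b, C a → C b → G.Adj a b → s(a, b) ∈ D := by
    rintro a b ⟨e, he, hae⟩ ⟨f, hf, hbf⟩ hab
    by_cases hef : e = f
    · subst hef
      rwa [← (Sym2.mem_and_mem_iff hab.ne).1 ⟨hae, hbf⟩]
    · rcases hP e he f hf hef a hae b hbf hab with h | h <;> rw [h] <;> assumption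
  have hLC : ∀ v, L v → C v := by
    rintro v ⟨e, he, rfl⟩
    exact ⟨e, he, hle e he⟩
  -- A selected endpoint lies on one edge only, and each edge selects one endpoint, so no edge of
  -- `D` has two leaves.
  have two : ∀ a b, s(a, b) ∈ D → L a → ¬ L b := by
    rintro a b hab ⟨e, he, rfl⟩ ⟨f, hf, rfl⟩
    have h1 := huniq e he _ hab (Sym2.mem_mk_left _ _)
    have h2 := huniq f hf _ hab (Sym2.mem_mk_right _ _)
    have : e = f := h1.symm.trans h2
    subst this
    exact G.irrefl (hE hab)
  have one : ∀ a b, s(a, b) ∈ D → L a ∨ L b := by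
    intro a b hab
    rcases Sym2.mem_iff.1 (hle _ hab) with h | h
    · exact Or.inl ⟨_, hab, h⟩
    · exact Or.inr ⟨_, hab, h⟩
  let x : V → Label := fun v => if L v then .leaf else if C v then .center else .zero
  have hxl : ∀ v, x v = .leaf ↔ L v := by
    intro v
    simp only [x]
    split_ifs <;> simp_all
  have hxc : ∀ v, x v = .center ↔ C v ∧ ¬ L v := by
    intro v
    simp only [x]
    split_ifs <;> simp_all
  have hxz : ∀ v, x v = .zero ↔ ¬ C v := by
    intro v
    have := hLC v
    simp only [x]
    split_ifs <;> simp_all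
  refine ⟨x, ⟨?_, ?_⟩, ?_⟩
  · intro u _ v _ huv
    rw [hxz, hxz, hxl, hxl, hxc, hxc]
    by_cases hu : C u
    · by_cases hv : C v
      · have h := key u v hu hv huv
        right; right
        by_cases h1 : L u
        · exact Or.inl ⟨h1, hv, two u v h h1⟩
        · exact Or.inr ⟨⟨hu, h1⟩, (one u v h).resolve_left h1⟩
      · exact Or.inr (Or.inl hv)
    · exact Or.inl hu
  · intro u _ hu
    rw [hxl] at hu
    obtain ⟨e, he, rfl⟩ := hu
    obtain ⟨c, hc⟩ := hle e he
    have hce : c ∈ e := by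
      rw [hc]
      exact Sym2.mem_mk_right _ _
    have hin : s(l e, c) ∈ D := hc ▸ he
    refine ⟨c, hW e he c hce, hE hin, ?_, ?_⟩
    · rw [hxc]
      exact ⟨⟨e, he, hce⟩, two _ _ hin ⟨e, he, rfl⟩⟩
    · intro z _ hz hxz'
      rw [hxc] at hxz'
      have h1 := key _ _ (hLC _ ⟨e, he, rfl⟩) hxz'.1 hz
      have h2 := huniq e he _ h1 (Sym2.mem_mk_left _ _)
      rw [← Sym2.congr_right (a := l e), h2]
      exact hc
  · refine Finset.card_bij (fun e _ => l e) ?_ ?_ ?_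
    · intro e he
      rw [Finset.mem_filter, hxl]
      exact ⟨hW e he _ (hle e he), e, he, rfl⟩
    · intro e he f hf h
      exact huniq f hf e he (h ▸ hle e he)
    · intro v hv
      rw [Finset.mem_filter, hxl] at hv
      obtain ⟨e, he, h⟩ := hv.2
      exact ⟨e, he, h⟩

theorem attains_leafWeight_iff : Attains G W leafWeight 0 m ↔ HasPacking G W m := by
  constructor
  · rintro ⟨x, hx, hm⟩
    rw [zero_add, sum_leafWeight] at hm
    obtain ⟨D, h1, h2, h3⟩ := hx.hasPacking
    exact ⟨D, h1, h2, hm.trans h3⟩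
  · rintro ⟨D, h1, h2, h3⟩
    obtain ⟨x, hx, hc⟩ := h1.exists_isLabeling h2
    refine ⟨x, hx, ?_⟩
    rw [zero_add, sum_leafWeight, ← hc]
    exact h3

/-- Edges correspond to leaves. For the whole vertex set this shows that `n` pairs suffice for the
output. -/
theorem HasPacking.le_card (h : HasPacking G W m) : m ≤ W.card := by
  obtain ⟨x, -, hm⟩ := attains_leafWeight_iff.2 h
  rw [zero_add, sum_leafWeight] at hm
  exact hm.trans (Finset.card_filter_le _ _)

theorem hasPacking_univ_iff [Fintype V] :
    HasPacking G Finset.univ m ↔ m ≤ edgeOpenPackingNumber G := by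
  constructor
  · rintro ⟨D, h1, -, h3⟩
    exact h3.trans (card_le_edgeOpenPackingNumber G D h1)
  · intro h
    obtain ⟨D, h1, h2⟩ := exists_card_eq_edgeOpenPackingNumber G
    exact ⟨D, h1, by simp, h2 ▸ h⟩

/-- If no vertex of `W` can be spared, then the edges inside `W` form a maximum edge open
packing set. -/
theorem HasPacking.exists_of_critical [Finite V] [DecidableEq V]
    (h : HasPacking G W (edgeOpenPackingNumber G))
    (hcrit : ∀ v ∈ W, ¬ HasPacking G (W.erase v) (edgeOpenPackingNumber G)) :
    ∃ D : Finset (Sym2 V), IsEdgeOpenPacking G (D : Set (Sym2 V)) ∧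
      D.card = edgeOpenPackingNumber G ∧ ∀ e, e ∈ D ↔ e ∈ G.edgeSet ∧ ∀ v ∈ e, v ∈ W := by
  obtain ⟨D, h1, h2, h3⟩ := h
  refine ⟨D, h1, (card_le_edgeOpenPackingNumber G D h1).antisymm h3, fun e => ⟨fun he =>
    ⟨h1.1 he, h2 e he⟩, ?_⟩⟩
  -- A vertex of `W` missed by `D` could be spared. Once all of `W` is covered, the packing
  -- condition puts every edge inside `W` into `D`.
  have hcov : ∀ v ∈ W, ∃ e ∈ D, v ∈ e := by
    intro v hv
    by_contra! hcon
    exact hcrit v hv ⟨D, h1, fun e he w hw =>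
      Finset.mem_erase.2 ⟨fun hvw => hcon e he (hvw ▸ hw), h2 e he w hw⟩, h3⟩
  induction e using Sym2.ind with
  | _ a b =>
    rintro ⟨hab, hW⟩
    obtain ⟨e, he, hae⟩ := hcov a (hW a (Sym2.mem_mk_left _ _))
    obtain ⟨f, hf, hbf⟩ := hcov b (hW b (Sym2.mem_mk_right _ _))
    by_cases hef : e = f
    · subst hef
      have hne : a ≠ b := (show G.Adj a b from hab).ne
      rwa [← (Sym2.mem_and_mem_iff hne).1 ⟨hae, hbf⟩]
    · rcases h1.2 e he f hf hef a hae b hbf hab with h | h <;> rw [h] <;> assumption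

end EOP

/-! ## Structured programs for random access machines -/

/-- Apply `f (N - 1)`, …, `f 1`, `f 0`, in this order. -/
def countdown {σ : Type*} (f : ℕ → σ → σ) : ℕ → σ → σ
  | 0, s => s
  | k + 1, s => countdown f k (f k s)

/-- `P k` is the invariant that holds once the indices `k, …, N - 1` have been dealt with. -/
theorem countdown_induction {σ : Type*} {f : ℕ → σ → σ} {P : ℕ → σ → Prop} {N : ℕ} {s : σ}
    (h : P N s) (hf : ∀ k < N, ∀ s, P (k + 1) s → P k (f k s)) : P 0 (countdown f N s) := by
  induction N generalizing s with
  | zero => exact h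
  | succ N ih => exact ih (hf N (Nat.lt_succ_self N) s h) fun k hk => hf k (by omega)

namespace RAM

/-- Registers and memory. -/
structure Store : Type where
  reg : ℕ → ℕ
  mem : ℕ → ℕ

/-- Change one register. -/
def Store.setReg (s : Store) (d k : ℕ) : Store := { s with reg := Function.update s.reg d k }

@[simp] theorem Store.setReg_reg (s : Store) (d k r : ℕ) :
    (s.setReg d k).reg r = if r = d then k else s.reg r := by
  simp [Store.setReg, Function.update_apply]

@[simp] theorem Store.setReg_mem (s : Store) (d k : ℕ) : (s.setReg d k).mem = s.mem := rfl

/-- Structured commands: single instructions, composition, branching on whether a register is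
nonzero, and loops that run as often as register `0` says, with a counter that counts down. -/
inductive Cmd : Type
  | const (d k : ℕ)
  | add (d a b : ℕ)
  | sub (d a b : ℕ)
  | load (d a : ℕ)
  | store (a b : ℕ)
  | seq (c₁ c₂ : Cmd)
  | ite (a : ℕ) (c₁ c₂ : Cmd)
  | loop (i : ℕ) (c : Cmd)

namespace Cmd

/-- The effect of a command. -/
def run : Cmd → Store → Store
  | const d k, s => s.setReg d k
  | add d a b, s => s.setReg d (s.reg a + s.reg b)
  | sub d a b, s => s.setReg d (s.reg a - s.reg b)
  | load d a, s => s.setReg d (s.mem (s.reg a))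
  | store a b, s => { s with mem := Function.update s.mem (s.reg a) (s.reg b) }
  | seq c₁ c₂, s => c₂.run (c₁.run s)
  | ite a c₁ c₂, s => if s.reg a = 0 then c₂.run s else c₁.run s
  | loop i c, s => countdown (fun k s => c.run (s.setReg i k)) (s.reg 0) (s.setReg i (s.reg 0))

/-- The command may change register `r`. -/
def Writes (r : ℕ) : Cmd → Prop
  | const d _ => r = d
  | add d _ _ => r = d
  | sub d _ _ => r = d
  | load d _ => r = d
  | store _ _ => False
  | seq c₁ c₂ => c₁.Writes r ∨ c₂.Writes r
  | ite _ c₁ c₂ => c₁.Writes r ∨ c₂.Writes r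
  | loop i c => r = i ∨ c.Writes r

/-- No loop changes its own counter in its body. -/
def LoopsOk : Cmd → Prop
  | seq c₁ c₂ => c₁.LoopsOk ∧ c₂.LoopsOk
  | ite _ c₁ c₂ => c₁.LoopsOk ∧ c₂.LoopsOk
  | loop i c => ¬ c.Writes i ∧ c.LoopsOk
  | _ => True

/-- The command can be translated: it changes neither register `0`, which holds the number of
iterations of all loops, nor register `1`, which holds the number one. -/
structure Ok (c : Cmd) : Prop where
  loops : c.LoopsOk
  zero : ¬ c.Writes 0
  one : ¬ c.Writes 1

/-- Applied to registers `0` and `1` and to loop counters, this keeps the iteration bound, the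
number one and the counters of enclosing loops fixed. -/
theorem run_reg_of_not_writes {r : ℕ} {c : Cmd} (h : ¬ c.Writes r) (s : Store) :
    (c.run s).reg r = s.reg r := by
  induction c generalizing s with
  | seq c₁ c₂ h₁ h₂ =>
    simp only [Writes, not_or] at h
    rw [run, h₂ h.2, h₁ h.1]
  | ite a c₁ c₂ h₁ h₂ =>
    simp only [Writes, not_or] at h
    rw [run]
    split_ifs
    · exact h₂ h.2 s
    · exact h₁ h.1 s
  | loop i c ih =>
    simp only [Writes, not_or] at h
    rw [run]
    refine countdown_induction (P := fun _ (t : Store) => t.reg r = s.reg r) (by simp [h.1]) ?_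
    intro k _ t ht
    rw [ih h.2]
    simpa [h.1] using ht
  | _ => simp_all [Writes, run]

/-- The length of the machine code of a command. -/
def size : Cmd → ℕ
  | seq c₁ c₂ => c₁.size + c₂.size
  | ite _ c₁ c₂ => c₁.size + c₂.size + 2
  | loop _ c => c.size + 5
  | _ => 1

/-- Machine code of a command, to be placed at instruction number `b`. -/
def code : Cmd → ℕ → Program
  | const d k, _ => [.const d k]
  | add d x y, _ => [.add d x y]
  | sub d x y, _ => [.sub d x y]
  | load d x, _ => [.load d x]
  | store x y, _ => [.store x y]
  | seq c₁ c₂, b => c₁.code b ++ c₂.code (b + c₁.size)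
  | ite a c₁ c₂, b => [.jumpZero a (b + 1 + c₁.size + 1)] ++ (c₁.code (b + 1) ++
      ([.jump (b + (c₁.size + c₂.size + 2))] ++ c₂.code (b + 1 + c₁.size + 1)))
  | loop i c, b => [.const i 0] ++ ([.add i i 0] ++ ([.jumpZero i (b + c.size + 5)] ++
      ([.sub i i 1] ++ (c.code (b + 1 + 1 + 1 + 1) ++ [.jump (b + 1 + 1)]))))

/-- A bound for the number of steps, as a polynomial in register `0`. -/
noncomputable def time : Cmd → Polynomial ℕ
  | seq c₁ c₂ => c₁.time + c₂.time
  | ite _ c₁ c₂ => c₁.time + c₂.time + 2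
  | loop _ c => Polynomial.X * (c.time + 3) + 3
  | _ => 1

theorem length_code (c : Cmd) (b : ℕ) : (c.code b).length = c.size := by
  induction c generalizing b with
  | seq c₁ c₂ h₁ h₂ => simp [code, size, h₁, h₂]
  | ite a c₁ c₂ h₁ h₂ => simp [code, size, h₁, h₂]; omega
  | loop i c ih => simp [code, size, ih]
  | _ => simp [code, size]

end Cmd

/-! ### Correctness and running time of the machine code. -/

/-- The program goes from `c` to `c'` in `t` steps. -/
def Steps (p : Program) : ℕ → Config → Config → Prop
  | 0, c, c' => c' = c
  | t + 1, c, c' => ∃ d, step p c = some d ∧ Steps p t d c'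

theorem Steps.trans {p : Program} {t t' : ℕ} {c d e : Config} (h : Steps p t c d)
    (h' : Steps p t' d e) : Steps p (t + t') c e := by
  induction t generalizing c with
  | zero =>
    have h : d = c := h
    subst h
    rwa [Nat.zero_add]
  | succ t ih =>
    obtain ⟨x, hx, h⟩ := h
    rw [Nat.succ_add]
    exact ⟨x, hx, ih h⟩

theorem Steps.haltsIn {p : Program} {t : ℕ} {c d : Config} (h : Steps p t c d)
    (hd : step p d = none) : HaltsIn p t c d := by
  induction t generalizing c with
  | zero =>
    have h : d = c := h
    subst h
    exact ⟨hd, rfl⟩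
  | succ t ih =>
    obtain ⟨x, hx, h⟩ := h
    exact ⟨x, hx, ih h⟩

theorem prefix_drop_append {p l₁ l₂ : Program} {b : ℕ} (h : l₁ ++ l₂ <+: p.drop b) :
    l₁ <+: p.drop b ∧ l₂ <+: p.drop (b + l₁.length) := by
  obtain ⟨r, hr⟩ := h
  refine ⟨⟨l₂ ++ r, by rw [← hr, List.append_assoc]⟩, ⟨r, ?_⟩⟩
  rw [← List.drop_drop, ← hr, List.append_assoc, List.drop_left]

theorem step_of_prefix {p : Program} {i : Instr} {c : Config} (h : [i] <+: p.drop c.pc) :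
    step p c = some (i.exec c) := by
  obtain ⟨r, hr⟩ := h
  have : p[c.pc]? = some i := by
    have := congrArg (fun l : Program => l[0]?) hr
    simpa using this.symm
  simp [step, this]

theorem steps_one {p : Program} {i : Instr} {c : Config} (h : [i] <+: p.drop c.pc) :
    Steps p 1 c (i.exec c) :=
  ⟨_, step_of_prefix h, rfl⟩

/-- The machine code of a command has the effect of the command, within the time bound. -/
theorem Cmd.steps_code {p : Program} {c : Cmd} (hc : c.Ok) {b : ℕ} (hp : c.code b <+: p.drop b)
    (s : Store) (hs : s.reg 1 = 1) :
    ∃ t ≤ c.time.eval (s.reg 0),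
      Steps p t ⟨b, s.reg, s.mem⟩ ⟨b + c.size, (c.run s).reg, (c.run s).mem⟩ := by
  induction c generalizing b s with
  | seq c₁ c₂ h₁ h₂ =>
    obtain ⟨hl, hz, ho⟩ := hc
    simp only [LoopsOk, Writes, not_or] at hl hz ho
    obtain ⟨hp₁, hp₂⟩ := prefix_drop_append hp
    rw [length_code] at hp₂
    obtain ⟨t₁, ht₁, hs₁⟩ := h₁ ⟨hl.1, hz.1, ho.1⟩ hp₁ s hs
    obtain ⟨t₂, ht₂, hs₂⟩ := h₂ ⟨hl.2, hz.2, ho.2⟩ hp₂ (c₁.run s)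
      (by rw [run_reg_of_not_writes ho.1, hs])
    rw [run_reg_of_not_writes hz.1] at ht₂
    refine ⟨t₁ + t₂, ?_, ?_⟩
    · rw [time, Polynomial.eval_add]
      omega
    · have := hs₁.trans hs₂
      rwa [Nat.add_assoc] at this
  | ite a c₁ c₂ h₁ h₂ =>
    obtain ⟨hl, hz, ho⟩ := hc
    simp only [LoopsOk, Writes, not_or] at hl hz ho
    obtain ⟨hj, hp⟩ := prefix_drop_append hp
    obtain ⟨hp₁, hp⟩ := prefix_drop_append hp
    obtain ⟨hj', hp₂⟩ := prefix_drop_append hp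
    simp only [length_code, List.length_singleton] at hp₁ hj' hp₂
    have h0 := steps_one (c := ⟨b, s.reg, s.mem⟩) hj
    rw [time, Polynomial.eval_add, Polynomial.eval_add, run]
    simp only [Polynomial.eval_ofNat]
    by_cases ha : s.reg a = 0
    · obtain ⟨t, ht, hst⟩ := h₂ ⟨hl.2, hz.2, ho.2⟩ hp₂ s hs
      simp only [Instr.exec, if_pos ha] at h0
      refine ⟨1 + t, by omega, ?_⟩
      rw [if_pos ha]
      have := h0.trans hst
      rwa [show b + 1 + c₁.size + 1 + c₂.size = b + (ite a c₁ c₂).size by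
        simp only [size]; omega] at this
    · obtain ⟨t, ht, hst⟩ := h₁ ⟨hl.1, hz.1, ho.1⟩ hp₁ s hs
      simp only [Instr.exec, if_neg ha] at h0
      refine ⟨1 + t + 1, by omega, ?_⟩
      rw [if_neg ha]
      have h3 := steps_one (c := ⟨b + 1 + c₁.size, (c₁.run s).reg, (c₁.run s).mem⟩) hj'
      exact (h0.trans hst).trans h3
  | loop i c ih =>
    obtain ⟨hl, hz, ho⟩ := hc
    simp only [LoopsOk, Writes, not_or] at hl hz ho
    obtain ⟨hp₁, hp⟩ := prefix_drop_append hp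
    obtain ⟨hp₂, hp⟩ := prefix_drop_append hp
    obtain ⟨hp₃, hp⟩ := prefix_drop_append hp
    obtain ⟨hp₄, hp⟩ := prefix_drop_append hp
    obtain ⟨hp₅, hp₆⟩ := prefix_drop_append hp
    simp only [length_code, List.length_singleton] at hp₂ hp₃ hp₄ hp₅ hp₆
    -- Induction on the counter, starting at the loop test: test, decrement and jump back cost three
    -- steps per round, and the final test one more.
    have key : ∀ k (r : Store), r.reg i = k → r.reg 1 = 1 → r.reg 0 = s.reg 0 →
        ∃ t ≤ k * (c.time.eval (s.reg 0) + 3) + 1,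
          Steps p t ⟨b + 1 + 1, r.reg, r.mem⟩ ⟨b + (loop i c).size,
            (countdown (fun k s => c.run (s.setReg i k)) k r).reg,
            (countdown (fun k s => c.run (s.setReg i k)) k r).mem⟩ := by
      intro k
      induction k with
      | zero =>
        intro r hri _ _
        have h3 := steps_one (c := ⟨b + 1 + 1, r.reg, r.mem⟩) hp₃
        simp only [Instr.exec, if_pos hri] at h3
        exact ⟨1, by omega, h3⟩
      | succ k ihk =>
        intro r hri hr1 hr0
        have h3 := steps_one (c := ⟨b + 1 + 1, r.reg, r.mem⟩) hp₃
        simp only [Instr.exec, hri, Nat.succ_ne_zero, if_false] at h3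
        have h4 := steps_one (c := ⟨b + 1 + 1 + 1, r.reg, r.mem⟩) hp₄
        simp only [Instr.exec, hri, hr1, Nat.add_sub_cancel] at h4
        have e1 : (r.setReg i k).reg 1 = 1 := by simp [ho.1, hr1]
        have e0 : (r.setReg i k).reg 0 = s.reg 0 := by simp [hz.1, hr0]
        obtain ⟨t, ht, h5⟩ := ih ⟨hl.2, hz.2, ho.2⟩ hp₅ (r.setReg i k) e1
        rw [e0] at ht
        have h6 := steps_one (c := ⟨b + 1 + 1 + 1 + 1 + c.size, (c.run (r.setReg i k)).reg,
          (c.run (r.setReg i k)).mem⟩) hp₆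
        obtain ⟨t', ht', h7⟩ := ihk (c.run (r.setReg i k))
          (by rw [run_reg_of_not_writes hl.1]; simp)
          (by rw [run_reg_of_not_writes ho.2, e1]) (by rw [run_reg_of_not_writes hz.2, e0])
        refine ⟨1 + 1 + t + 1 + t', ?_, (((h3.trans h4).trans h5).trans h6).trans h7⟩
        rw [Nat.succ_mul]
        omega
    have h1 := steps_one (c := ⟨b, s.reg, s.mem⟩) hp₁
    have h2 := steps_one (c := ⟨b + 1, (s.setReg i 0).reg, s.mem⟩) hp₂
    -- In place of a move instruction, clearing the counter and adding register `0` copies the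
    -- bound; this needs the counter to be different from register `0`.
    have e : Function.update (s.setReg i 0).reg i
        ((s.setReg i 0).reg i + (s.setReg i 0).reg 0) = (s.setReg i (s.reg 0)).reg := by
      funext r
      simp only [Function.update_apply, Store.setReg_reg, if_true, if_neg hz.1, Nat.zero_add]
      split_ifs <;> rfl
    simp only [Instr.exec, e] at h2
    obtain ⟨t, ht, h3⟩ := key (s.reg 0) (s.setReg i (s.reg 0)) (by simp) (by simp [ho.1, hs])
      (by simp [hz.1])
    refine ⟨1 + 1 + t, ?_, (h1.trans h2).trans h3⟩
    simp only [time, Polynomial.eval_add, Polynomial.eval_mul, Polynomial.eval_X,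
      Polynomial.eval_ofNat]
    omega
  | const d k => exact ⟨1, by simp [time], steps_one (i := .const d k) (c := ⟨b, s.reg, s.mem⟩) hp⟩
  | add d x y => exact ⟨1, by simp [time], steps_one (i := .add d x y) (c := ⟨b, s.reg, s.mem⟩) hp⟩
  | sub d x y => exact ⟨1, by simp [time], steps_one (i := .sub d x y) (c := ⟨b, s.reg, s.mem⟩) hp⟩
  | load d x => exact ⟨1, by simp [time], steps_one (i := .load d x) (c := ⟨b, s.reg, s.mem⟩) hp⟩
  | store x y => exact ⟨1, by simp [time], steps_one (i := .store x y) (c := ⟨b, s.reg, s.mem⟩) hp⟩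

/-- The program that puts the content of memory cell `0` into register `0` and the number one into
register `1`, and then runs the command. -/
def Cmd.program (c : Cmd) : Program := .load 0 0 :: .const 1 1 :: c.code 2

theorem Cmd.haltsIn_program {c : Cmd} (hc : c.Ok) {m : ℕ → ℕ} {s : Store}
    (hs : s = ⟨fun r => if r = 0 then m 0 else if r = 1 then 1 else 0, m⟩) :
    ∃ t ≤ (c.time + 2).eval (m 0), ∃ pc,
      HaltsIn c.program t ⟨0, fun _ => 0, m⟩ ⟨pc, (c.run s).reg, (c.run s).mem⟩ := by
  have h0 : Steps c.program 1 ⟨0, fun _ => 0, m⟩ ⟨1, Function.update (fun _ => 0) 0 (m 0), m⟩ :=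
    steps_one (i := .load 0 0) ⟨.const 1 1 :: c.code 2, rfl⟩
  have h1 := steps_one (p := c.program) (i := .const 1 1)
    (c := ⟨1, Function.update (fun _ => 0) 0 (m 0), m⟩) ⟨c.code 2, rfl⟩
  have e : Function.update (Function.update (fun _ => 0) 0 (m 0)) 1 1 = s.reg := by
    subst hs
    funext r
    simp only [Function.update_apply]
    split_ifs <;> simp_all
  have e' : m = s.mem := by rw [hs]
  simp only [Instr.exec, e] at h1
  obtain ⟨t, ht, h2⟩ := Cmd.steps_code (p := c.program) hc (b := 2) ⟨[], by simp [program]⟩ s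
    (by simp [hs])
  have hr0 : s.reg 0 = m 0 := by simp [hs]
  rw [← e'] at h2
  refine ⟨1 + 1 + t, ?_, 2 + c.size, ((h0.trans h1).trans h2).haltsIn ?_⟩
  · rw [Polynomial.eval_add, Polynomial.eval_ofNat, ← hr0]
    omega
  · have : c.program.length ≤ 2 + c.size := by
      simp [program, length_code]
      omega
    simp [step, List.getElem?_eq_none this]

end RAM

/-! ## A small imperative language with variables and arrays -/

namespace Imp

open RAM

/-- Variables. -/
inductive Var : Type
  | u | w | z | i | j | t | v | pend | twin | acc | best | count
  deriving DecidableEq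

/-- Arrays: the candidate set, the set of remaining vertices, the weights of the labels, and the
endpoints of the edges that are put out. -/
inductive Arr : Type
  | cand | alive | weight (l : EOP.Label) | fst | snd
  deriving DecidableEq

/-- The number of a variable. -/
def Var.idx : Var → ℕ
  | u => 0 | w => 1 | z => 2 | i => 3 | j => 4 | t => 5 | v => 6 | pend => 7 | twin => 8
  | acc => 9 | best => 10 | count => 11

/-- The number of an array. -/
def Arr.idx : Arr → ℕ
  | cand => 0 | alive => 1 | fst => 2 | snd => 3
  | weight .zero => 4 | weight .leaf => 5 | weight .center => 6 | weight .closed => 7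

theorem Var.idx_injective : Function.Injective Var.idx := by
  intro x y h
  cases x <;> cases y <;> first | rfl | cases h

/-- The eight arrays are interleaved, entry `i` of `a` having offset `8 * i + a.idx`; indices below
eight make these offsets distinct. -/
theorem Arr.idx_lt (a : Arr) : a.idx < 8 := by
  rcases a with _ | _ | (_ | _ | _ | _) | _ | _ <;> simp [Arr.idx]

theorem Arr.idx_injective : Function.Injective Arr.idx := by
  intro x y h
  rcases x with _ | _ | (_ | _ | _ | _) | _ | _ <;>
    rcases y with _ | _ | (_ | _ | _ | _) | _ | _ <;> first | rfl | cases h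

/-- The values of all variables and arrays. -/
structure State : Type where
  var : Var → ℕ
  arr : Arr → ℕ → ℕ

/-- Change one variable. -/
def State.set (s : State) (x : Var) (k : ℕ) : State := { s with var := Function.update s.var x k }

/-- Change one array entry. -/
def State.put (s : State) (a : Arr) (i k : ℕ) : State :=
  { s with arr := Function.update s.arr a (Function.update (s.arr a) i k) }

@[simp] theorem State.set_var (s : State) (x y : Var) (k : ℕ) :
    (s.set x k).var y = if y = x then k else s.var y := by
  simp [State.set, Function.update_apply]

@[simp] theorem State.set_arr (s : State) (x : Var) (k : ℕ) : (s.set x k).arr = s.arr := rfl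

@[simp] theorem State.put_var (s : State) (a : Arr) (i k : ℕ) : (s.put a i k).var = s.var := rfl

@[simp] theorem State.put_arr (s : State) (a b : Arr) (i j k : ℕ) :
    (s.put a i k).arr b j = if b = a ∧ j = i then k else s.arr b j := by
  by_cases h : b = a
  · subst h
    simp [State.put, Function.update_apply]
  · simp [State.put, h]

/-- Expressions. `adj e f` is an entry of the adjacency matrix. -/
inductive Exp : Type
  | num (k : ℕ)
  | var (x : Var)
  | add (e f : Exp)
  | sub (e f : Exp)
  | get (a : Arr) (e : Exp)
  | adj (e f : Exp)

/-- The value of an expression, for the adjacency matrix `A` of size `n`. -/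
def Exp.eval (n : ℕ) (A : ℕ → ℕ → ℕ) (s : State) : Exp → ℕ
  | num k => k
  | var x => s.var x
  | add e f => e.eval n A s + f.eval n A s
  | sub e f => e.eval n A s - f.eval n A s
  | get a e => s.arr a (e.eval n A s)
  | adj e f => if e.eval n A s < n ∧ f.eval n A s < n then A (e.eval n A s) (f.eval n A s) else 0

/-- Statements. `loop x c` runs `c` for `x = n - 1, …, 1, 0`. -/
inductive Stmt : Type
  | assign (x : Var) (e : Exp)
  | put (a : Arr) (e f : Exp)
  | seq (c₁ c₂ : Stmt)
  | ite (e : Exp) (c₁ c₂ : Stmt)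
  | loop (x : Var) (c : Stmt)

namespace Stmt

/-- The effect of a statement. -/
def run (n : ℕ) (A : ℕ → ℕ → ℕ) : Stmt → State → State
  | assign x e, s => s.set x (e.eval n A s)
  | put a e f, s => s.put a (e.eval n A s) (f.eval n A s)
  | seq c₁ c₂, s => c₂.run n A (c₁.run n A s)
  | ite e c₁ c₂, s => if e.eval n A s = 0 then c₂.run n A s else c₁.run n A s
  | loop x c, s => countdown (fun k s => c.run n A (s.set x k)) n (s.set x n)

/-- The statement may change the variable `x`. -/
def Writes (x : Var) : Stmt → Prop
  | assign y _ => x = y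
  | put _ _ _ => False
  | seq c₁ c₂ => c₁.Writes x ∨ c₂.Writes x
  | ite _ c₁ c₂ => c₁.Writes x ∨ c₂.Writes x
  | loop y c => x = y ∨ c.Writes x

/-- No loop changes its own counter in its body. -/
def LoopsOk : Stmt → Prop
  | seq c₁ c₂ => c₁.LoopsOk ∧ c₂.LoopsOk
  | ite _ c₁ c₂ => c₁.LoopsOk ∧ c₂.LoopsOk
  | loop x c => ¬ c.Writes x ∧ c.LoopsOk
  | _ => True

end Stmt

/-! ### Translation to structured programs for random access machines -/

/-- The register of a variable. -/
def vreg (x : Var) : ℕ := 2 * x.idx + 3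

/-- The registers for intermediate results. -/
def tmp (d : ℕ) : ℕ := 2 * d + 4

/-- Turn the index in register `tmp d` into the address of the entry of the array `a`. -/
def addrCmd (a : Arr) (d : ℕ) : Cmd :=
  .seq (.add (tmp d) (tmp d) (tmp d)) <| .seq (.add (tmp d) (tmp d) (tmp d)) <|
  .seq (.add (tmp d) (tmp d) (tmp d)) <| .seq (.const (tmp (d + 1)) a.idx) <|
  .seq (.add (tmp d) (tmp d) (tmp (d + 1))) (.add (tmp d) (tmp d) 2)

/-- Read the entry of the adjacency matrix given by the registers `tmp d` and `tmp (d + 1)`. -/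
def adjCmd (d : ℕ) : Cmd :=
  .seq (.add (tmp (d + 2)) (tmp d) 1) <| .seq (.sub (tmp (d + 2)) (tmp (d + 2)) 0) <|
  .seq (.add (tmp (d + 3)) (tmp (d + 1)) 1) <| .seq (.sub (tmp (d + 3)) (tmp (d + 3)) 0) <|
  .seq (.add (tmp (d + 2)) (tmp (d + 2)) (tmp (d + 3))) <|
  .ite (tmp (d + 2)) (.const (tmp d) 0) <|
  .seq (.add (tmp (d + 2)) (tmp (d + 1)) 1) <|
  .seq (.loop (tmp (d + 3)) (.add (tmp (d + 2)) (tmp (d + 2)) (tmp d)))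
    (.load (tmp d) (tmp (d + 2)))

/-- Evaluate an expression into the register `tmp d`. -/
def Exp.compile : Exp → ℕ → Cmd
  | num k, d => .const (tmp d) k
  | var x, d => .seq (.const (tmp d) 0) (.add (tmp d) (tmp d) (vreg x))
  | add e f, d => .seq (e.compile d) (.seq (f.compile (d + 1)) (.add (tmp d) (tmp d) (tmp (d + 1))))
  | sub e f, d => .seq (e.compile d) (.seq (f.compile (d + 1)) (.sub (tmp d) (tmp d) (tmp (d + 1))))
  | get a e, d => .seq (e.compile d) (.seq (addrCmd a d) (.load (tmp d) (tmp d)))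
  | adj e f, d => .seq (e.compile d) (.seq (f.compile (d + 1)) (adjCmd d))

/-- Translate a statement. -/
def Stmt.compile : Stmt → Cmd
  | assign x e => .seq (e.compile 0) (.seq (.const (vreg x) 0) (.add (vreg x) (vreg x) (tmp 0)))
  | put a e f => .seq (e.compile 0) <| .seq (addrCmd a 0) <| .seq (f.compile 1)
      (.store (tmp 0) (tmp 1))
  | seq c₁ c₂ => .seq c₁.compile c₂.compile
  | ite e c₁ c₂ => .seq (e.compile 0) (.ite (tmp 0) c₁.compile c₂.compile)
  | loop x c => .loop (vreg x) c.compile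

/-! ### Simulation of states by registers and memory. -/

/-- Registers and memory represent the state `s` and the adjacency matrix `A`. -/
structure Rel (n : ℕ) (A : ℕ → ℕ → ℕ) (s : State) (r : Store) : Prop where
  size : r.reg 0 = n
  one : r.reg 1 = 1
  base : r.reg 2 = (n + 1) * (n + 1)
  var : ∀ x, r.reg (vreg x) = s.var x
  arr : ∀ a i, r.mem (8 * i + a.idx + (n + 1) * (n + 1)) = s.arr a i
  adj : ∀ i < n, ∀ j < n, r.mem (1 + n * i + j) = A i j

theorem vreg_injective : Function.Injective vreg := fun x y h =>
  Var.idx_injective (by unfold vreg at h; omega)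

@[simp] theorem tmp_inj {d d' : ℕ} : tmp d = tmp d' ↔ d = d' := by
  unfold tmp
  omega

-- Variables occupy odd registers and intermediate results even ones.
@[simp] theorem tmp_ne_vreg (d : ℕ) (x : Var) : tmp d ≠ vreg x := by
  unfold tmp vreg
  omega

@[simp] theorem vreg_ne_tmp (d : ℕ) (x : Var) : vreg x ≠ tmp d := (tmp_ne_vreg d x).symm

theorem lt_tmp (d : ℕ) : 2 < tmp d := by
  unfold tmp
  omega

theorem lt_vreg (x : Var) : 2 < vreg x := by
  unfold vreg
  omega

/-- `r'` differs from `r` in the registers `tmp d`, `tmp (d + 1)`, … only. -/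
structure SameUpTo (d : ℕ) (r r' : Store) : Prop where
  mem : r'.mem = r.mem
  reg : ∀ q, (∀ k, d ≤ k → q ≠ tmp k) → r'.reg q = r.reg q

theorem SameUpTo.trans {d d' : ℕ} {r r' r'' : Store} (h : SameUpTo d r r')
    (h' : SameUpTo d' r' r'') (hd : d ≤ d') : SameUpTo d r r'' :=
  ⟨h'.mem.trans h.mem, fun q hq => (h'.reg q fun k hk => hq k (hd.trans hk)).trans (h.reg q hq)⟩

theorem SameUpTo.setReg {d k x : ℕ} (r : Store) (h : d ≤ k) : SameUpTo d r (r.setReg (tmp k) x) :=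
  ⟨rfl, fun q hq => by simp [hq k h]⟩

theorem SameUpTo.reg_of_le {d q : ℕ} {r r' : Store} (h : SameUpTo d r r') (hq : q ≤ 2) :
    r'.reg q = r.reg q :=
  h.reg q fun k _ => by have := lt_tmp k; omega

theorem SameUpTo.rel {n d : ℕ} {A : ℕ → ℕ → ℕ} {s : State} {r r' : Store} (h : SameUpTo d r r')
    (hr : Rel n A s r) : Rel n A s r' where
  size := (h.reg_of_le (by omega)).trans hr.size
  one := (h.reg_of_le (by omega)).trans hr.one
  base := (h.reg_of_le (by omega)).trans hr.base
  var x := (h.reg _ fun k _ => vreg_ne_tmp k x).trans (hr.var x)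
  arr a i := by rw [h.mem]; exact hr.arr a i
  adj i hi j hj := by rw [h.mem]; exact hr.adj i hi j hj

theorem cmd_run_seq (c₁ c₂ : Cmd) (r : Store) : (Cmd.seq c₁ c₂).run r = c₂.run (c₁.run r) := rfl

theorem addrCmd_run (a : Arr) (d : ℕ) (r : Store) :
    SameUpTo d r ((addrCmd a d).run r) ∧
      ((addrCmd a d).run r).reg (tmp d) = 8 * r.reg (tmp d) + a.idx + r.reg 2 := by
  have h := (lt_tmp d).ne
  have h' := (lt_tmp (d + 1)).ne
  refine ⟨⟨rfl, fun q hq => ?_⟩, ?_⟩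
  · have h1 := hq d le_rfl
    have h2 := hq (d + 1) (by omega)
    simp [addrCmd, Cmd.run, h1, h2]
  · simp [addrCmd, Cmd.run, h, h']
    omega

/-- Multiplication by repeated addition; the invariant is that with `k` rounds to go, `k` summands
are still missing. -/
theorem loop_add_run (d : ℕ) (r : Store) :
    SameUpTo (d + 2) r
        ((Cmd.loop (tmp (d + 3)) (.add (tmp (d + 2)) (tmp (d + 2)) (tmp d))).run r) ∧
      ((Cmd.loop (tmp (d + 3)) (.add (tmp (d + 2)) (tmp (d + 2)) (tmp d))).run r).reg (tmp (d + 2)) =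
        r.reg (tmp (d + 2)) + r.reg 0 * r.reg (tmp d) := by
  rw [Cmd.run]
  have := countdown_induction
    (f := fun k s => (Cmd.add (tmp (d + 2)) (tmp (d + 2)) (tmp d)).run (s.setReg (tmp (d + 3)) k))
    (P := fun k s => SameUpTo (d + 2) r s ∧ s.reg (tmp (d + 2)) + k * r.reg (tmp d) =
      r.reg (tmp (d + 2)) + r.reg 0 * r.reg (tmp d))
    (N := r.reg 0) (s := r.setReg (tmp (d + 3)) (r.reg 0))
    ⟨SameUpTo.setReg r (by omega), by simp⟩ ?_
  · simpa using this
  · rintro k _ s ⟨h1, h2⟩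
    have h3 : s.reg (tmp d) = r.reg (tmp d) := h1.reg _ fun j hj => by
      rw [Ne, tmp_inj]
      omega
    refine ⟨(h1.trans (SameUpTo.setReg s (k := d + 3) (by omega)) le_rfl).trans
      (SameUpTo.setReg _ (by omega)) le_rfl, ?_⟩
    simp only [Cmd.run, Store.setReg_reg, if_true, tmp_inj]
    rw [if_neg (by omega), if_neg (by omega), h3, ← h2, Nat.succ_mul]
    omega

theorem adjCmd_run {n d : ℕ} {A : ℕ → ℕ → ℕ} {s : State} {r : Store} (hr : Rel n A s r) :
    SameUpTo d r ((adjCmd d).run r) ∧ ((adjCmd d).run r).reg (tmp d) =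
      if r.reg (tmp d) < n ∧ r.reg (tmp (d + 1)) < n then
        A (r.reg (tmp d)) (r.reg (tmp (d + 1))) else 0 := by
  have ht : ∀ k, (0 : ℕ) ≠ tmp k ∧ (1 : ℕ) ≠ tmp k := fun k => by
    have := lt_tmp k
    omega
  have one : ∀ {k x : ℕ} (r : Store), d ≤ k → SameUpTo d r (r.setReg (tmp k) x) := fun r h =>
    SameUpTo.setReg r h
  have hz := hr.size
  have h1 := hr.one
  simp only [adjCmd, cmd_run_seq]
  set r₁ := (Cmd.add (tmp (d + 2)) (tmp d) 1).run r with e₁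
  set r₂ := (Cmd.sub (tmp (d + 2)) (tmp (d + 2)) 0).run r₁ with e₂
  set r₃ := (Cmd.add (tmp (d + 3)) (tmp (d + 1)) 1).run r₂ with e₃
  set r₄ := (Cmd.sub (tmp (d + 3)) (tmp (d + 3)) 0).run r₃ with e₄
  set r₅ := (Cmd.add (tmp (d + 2)) (tmp (d + 2)) (tmp (d + 3))).run r₄ with e₅
  have s5 : SameUpTo d r r₅ :=
    ((((one r (by omega)).trans (one r₁ (by omega)) le_rfl).trans
      (one r₂ (by omega)) le_rfl).trans (one r₃ (by omega)) le_rfl).trans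
      (one r₄ (by omega)) le_rfl
  have c0 : r₅.reg (tmp d) = r.reg (tmp d) := by
    simp [e₁, e₂, e₃, e₄, e₅, Cmd.run]
  have c1 : r₅.reg (tmp (d + 1)) = r.reg (tmp (d + 1)) := by
    simp [e₁, e₂, e₃, e₄, e₅, Cmd.run]
  -- The truncated difference `a + 1 - n` vanishes exactly if `a < n`, so the sum tests both bounds
  -- at once.
  have c2 : r₅.reg (tmp (d + 2)) = (r.reg (tmp d) + 1 - n) + (r.reg (tmp (d + 1)) + 1 - n) := by
    simp [e₁, e₂, e₃, e₄, e₅, Cmd.run, ht, hz, h1]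
  rw [Cmd.run]
  by_cases hlt : r.reg (tmp d) < n ∧ r.reg (tmp (d + 1)) < n
  · rw [if_pos (by omega), if_pos hlt]
    simp only [cmd_run_seq]
    have s6 : SameUpTo d r ((Cmd.add (tmp (d + 2)) (tmp (d + 1)) 1).run r₅) :=
      s5.trans (one r₅ (by omega)) le_rfl
    have c6 : ((Cmd.add (tmp (d + 2)) (tmp (d + 1)) 1).run r₅).reg (tmp (d + 2)) =
        r.reg (tmp (d + 1)) + 1 := by
      simp [Cmd.run, c1, s5.reg_of_le (q := 1) (by omega), h1]
    have c6' : ((Cmd.add (tmp (d + 2)) (tmp (d + 1)) 1).run r₅).reg (tmp d) = r.reg (tmp d) := by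
      simp [Cmd.run, c0]
    set r₆ := (Cmd.add (tmp (d + 2)) (tmp (d + 1)) 1).run r₅
    obtain ⟨s7, c7⟩ := loop_add_run d r₆
    set r₇ := (Cmd.loop (tmp (d + 3)) (Cmd.add (tmp (d + 2)) (tmp (d + 2)) (tmp d))).run r₆
    have s7' := s6.trans s7 (by omega)
    refine ⟨s7'.trans (one _ le_rfl) le_rfl, ?_⟩
    rw [Cmd.run, Store.setReg_reg, if_pos rfl, c7, c6, c6', s6.reg_of_le (by omega), hz, s7'.mem,
      ← hr.adj _ hlt.1 _ hlt.2]
    congr 1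
    omega
  · rw [if_neg (by omega), if_neg hlt]
    exact ⟨s5.trans (one _ le_rfl) le_rfl, by simp [Cmd.run]⟩

/-- The intermediate registers act as a stack: the second operand is evaluated from `tmp (d + 1)` on
and therefore preserves the first operand in `tmp d`. -/
theorem Exp.compile_run {n d : ℕ} {A : ℕ → ℕ → ℕ} {s : State} {r : Store} (e : Exp)
    (hr : Rel n A s r) :
    SameUpTo d r ((e.compile d).run r) ∧ ((e.compile d).run r).reg (tmp d) = e.eval n A s := by
  have lt : ∀ {r r' : Store}, SameUpTo (d + 1) r r' → r'.reg (tmp d) = r.reg (tmp d) :=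
    fun h => h.reg _ fun k hk => by rw [Ne, tmp_inj]; omega
  induction e generalizing d r with
  | num k => exact ⟨SameUpTo.setReg _ le_rfl, by simp [compile, Cmd.run, eval]⟩
  | var x =>
    exact ⟨(SameUpTo.setReg _ le_rfl).trans (SameUpTo.setReg _ le_rfl) le_rfl,
      by simp [compile, Cmd.run, eval, hr.var]⟩
  | add e f he hf =>
    obtain ⟨s1, c1⟩ := he (d := d) hr (fun h => h.reg _ fun k hk => by rw [Ne, tmp_inj]; omega)
    obtain ⟨s2, c2⟩ := hf (d := d + 1) (s1.rel hr)
      (fun h => h.reg _ fun k hk => by rw [Ne, tmp_inj]; omega)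
    refine ⟨(s1.trans s2 (by omega)).trans (SameUpTo.setReg _ le_rfl) le_rfl, ?_⟩
    simp only [compile, Cmd.run, eval, Store.setReg_reg, if_true]
    rw [c2, lt s2, c1]
  | sub e f he hf =>
    obtain ⟨s1, c1⟩ := he (d := d) hr (fun h => h.reg _ fun k hk => by rw [Ne, tmp_inj]; omega)
    obtain ⟨s2, c2⟩ := hf (d := d + 1) (s1.rel hr)
      (fun h => h.reg _ fun k hk => by rw [Ne, tmp_inj]; omega)
    refine ⟨(s1.trans s2 (by omega)).trans (SameUpTo.setReg _ le_rfl) le_rfl, ?_⟩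
    simp only [compile, Cmd.run, eval, Store.setReg_reg, if_true]
    rw [c2, lt s2, c1]
  | get a e he =>
    obtain ⟨s1, c1⟩ := he (d := d) hr (fun h => h.reg _ fun k hk => by rw [Ne, tmp_inj]; omega)
    obtain ⟨s2, c2⟩ := addrCmd_run a d ((e.compile d).run r)
    refine ⟨(s1.trans s2 le_rfl).trans (SameUpTo.setReg _ le_rfl) le_rfl, ?_⟩
    have hr' := s1.rel hr
    simp only [compile, Cmd.run, eval, Store.setReg_reg, if_true]
    rw [c2, c1, hr'.base, s2.mem, hr'.arr]
  | adj e f he hf =>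
    obtain ⟨s1, c1⟩ := he (d := d) hr (fun h => h.reg _ fun k hk => by rw [Ne, tmp_inj]; omega)
    obtain ⟨s2, c2⟩ := hf (d := d + 1) (s1.rel hr)
      (fun h => h.reg _ fun k hk => by rw [Ne, tmp_inj]; omega)
    have hr' := s2.rel (s1.rel hr)
    obtain ⟨s3, c3⟩ := adjCmd_run (d := d) hr'
    refine ⟨(s1.trans s2 (by omega)).trans s3 le_rfl, ?_⟩
    simp only [compile, Cmd.run, eval]
    rw [c3, c2, lt s2, c1]

theorem Rel.setVar {n : ℕ} {A : ℕ → ℕ → ℕ} {s : State} {r : Store} (hr : Rel n A s r) (x : Var)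
    (k : ℕ) : Rel n A (s.set x k) (r.setReg (vreg x) k) where
  size := by simp [(show (0 : ℕ) ≠ vreg x by have := lt_vreg x; omega), hr.size]
  one := by simp [(show (1 : ℕ) ≠ vreg x by have := lt_vreg x; omega), hr.one]
  base := by simp [(lt_vreg x).ne, hr.base]
  var y := by simp [vreg_injective.eq_iff, hr.var]
  arr := hr.arr
  adj := hr.adj

theorem Rel.put {n : ℕ} {A : ℕ → ℕ → ℕ} {s : State} {r : Store} (hr : Rel n A s r) (a : Arr)
    (i k : ℕ) : Rel n A (s.put a i k)
      { r with mem := Function.update r.mem (8 * i + a.idx + (n + 1) * (n + 1)) k } where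
  size := hr.size
  one := hr.one
  base := hr.base
  var := hr.var
  arr b j := by
    have ha := a.idx_lt
    have hb := b.idx_lt
    have : 8 * j + b.idx + (n + 1) * (n + 1) = 8 * i + a.idx + (n + 1) * (n + 1) ↔
        b = a ∧ j = i := by
      rw [← Arr.idx_injective.eq_iff]
      omega
    simp only [Function.update_apply, this, hr.arr, State.put_arr]
  adj i' hi j hj := by
    have : n * i' ≤ n * n := Nat.mul_le_mul_left n hi.le
    -- The matrix ends at cell `n * n`, before the arrays start.
    have h2 : 1 + n * i' + j ≠ 8 * i + a.idx + (n + 1) * (n + 1) := by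
      have : (n + 1) * (n + 1) = n * n + 2 * n + 1 := by ring
      omega
    simp [h2, hr.adj i' hi j hj]

/-- The translation of a statement has the effect of the statement. -/
theorem Stmt.compile_run {n : ℕ} {A : ℕ → ℕ → ℕ} {s : State} {r : Store} (c : Stmt)
    (hr : Rel n A s r) : Rel n A (c.run n A s) (c.compile.run r) := by
  induction c generalizing s r with
  | assign x e =>
    obtain ⟨s1, c1⟩ := e.compile_run (d := 0) hr
    have h := ((s1.rel hr).setVar x 0).setVar x (e.eval n A s)
    rw [show (s.set x 0).set x (e.eval n A s) = s.set x (e.eval n A s) by simp [State.set]] at h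
    simp only [compile, run, Cmd.run, Store.setReg_reg, if_true, if_neg (tmp_ne_vreg 0 x), c1,
      Nat.zero_add]
    exact h
  | put a e f =>
    obtain ⟨s1, c1⟩ := e.compile_run (d := 0) hr
    obtain ⟨s2, c2⟩ := addrCmd_run a 0 ((e.compile 0).run r)
    have s2' := s1.trans s2 le_rfl
    obtain ⟨s3, c3⟩ := f.compile_run (d := 1) (s2'.rel hr)
    have s3' := s2'.trans s3 (by omega)
    have c4 := s3.reg (tmp 0) fun k hk => by rw [Ne, tmp_inj]; omega
    have h := (s3'.rel hr).put a (e.eval n A s) (f.eval n A s)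
    simp only [compile, run, Cmd.run, c3]
    rwa [c4, c2, c1, (s1.rel hr).base]
  | seq c₁ c₂ h₁ h₂ => exact h₂ (h₁ hr)
  | ite e c₁ c₂ h₁ h₂ =>
    obtain ⟨s1, c1⟩ := e.compile_run (d := 0) hr
    simp only [compile, run, Cmd.run, c1]
    split_ifs
    · exact h₂ (s1.rel hr)
    · exact h₁ (s1.rel hr)
  | loop x c ih =>
    simp only [compile, run, Cmd.run, hr.size]
    have h := hr.setVar x n
    have key : ∀ N s' r', Rel n A s' r' →
        Rel n A (countdown (fun k s => c.run n A (s.set x k)) N s')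
          (countdown (fun k s => c.compile.run (s.setReg (vreg x) k)) N r') := by
      intro N
      induction N with
      | zero => exact fun _ _ h => h
      | succ N ihN => exact fun s' r' h => ihN _ _ (ih (h.setVar x N))
    exact key n _ _ h

theorem addrCmd_writes {a : Arr} {d q : ℕ} (h : (addrCmd a d).Writes q) :
    q = tmp d ∨ q = tmp (d + 1) := by
  simp only [addrCmd, Cmd.Writes] at h
  tauto

theorem Exp.compile_writes {e : Exp} {d q : ℕ} (h : (e.compile d).Writes q) :
    ∃ k, d ≤ k ∧ q = tmp k := by
  induction e generalizing d with
  | num k => exact ⟨d, le_rfl, h⟩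
  | var x => exact ⟨d, le_rfl, h.elim id id⟩
  | add e f he hf =>
    rcases h with h | h | h
    · exact he h
    · obtain ⟨k, hk, h⟩ := hf h
      exact ⟨k, by omega, h⟩
    · exact ⟨d, le_rfl, h⟩
  | sub e f he hf =>
    rcases h with h | h | h
    · exact he h
    · obtain ⟨k, hk, h⟩ := hf h
      exact ⟨k, by omega, h⟩
    · exact ⟨d, le_rfl, h⟩
  | get a e he =>
    rcases h with h | h | h
    · exact he h
    · rcases addrCmd_writes h with h | h
      · exact ⟨d, le_rfl, h⟩
      · exact ⟨d + 1, by omega, h⟩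
    · exact ⟨d, le_rfl, h⟩
  | adj e f he hf =>
    rcases h with h | h | h
    · exact he h
    · obtain ⟨k, hk, h⟩ := hf h
      exact ⟨k, by omega, h⟩
    · have : q = tmp d ∨ q = tmp (d + 2) ∨ q = tmp (d + 3) := by
        simp only [adjCmd, Cmd.Writes] at h
        tauto
      rcases this with h | h | h
      exacts [⟨d, le_rfl, h⟩, ⟨d + 2, by omega, h⟩, ⟨d + 3, by omega, h⟩]

theorem addrCmd_loopsOk (a : Arr) (d : ℕ) : (addrCmd a d).LoopsOk := by
  simp [addrCmd, Cmd.LoopsOk]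

theorem Exp.compile_loopsOk (e : Exp) (d : ℕ) : (e.compile d).LoopsOk := by
  induction e generalizing d with
  | num k => trivial
  | var x => exact ⟨trivial, trivial⟩
  | add e f he hf => exact ⟨he d, hf (d + 1), trivial⟩
  | sub e f he hf => exact ⟨he d, hf (d + 1), trivial⟩
  | get a e he => exact ⟨he d, addrCmd_loopsOk a d, trivial⟩
  | adj e f he hf =>
    refine ⟨he d, hf (d + 1), ?_⟩
    simp [adjCmd, Cmd.LoopsOk, Cmd.Writes]

theorem Stmt.compile_writes {c : Stmt} {q : ℕ} (h : c.compile.Writes q) :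
    (∃ k, q = tmp k) ∨ ∃ x, q = vreg x ∧ c.Writes x := by
  have hexp : ∀ {e : Exp} {d : ℕ}, (e.compile d).Writes q → ∃ k, q = tmp k := fun h => by
    obtain ⟨k, -, h⟩ := Exp.compile_writes h
    exact ⟨k, h⟩
  induction c with
  | assign x e =>
    rcases h with h | h | h
    · exact Or.inl (hexp h)
    · exact Or.inr ⟨x, h, rfl⟩
    · exact Or.inr ⟨x, h, rfl⟩
  | put a e f =>
    rcases h with h | h | h | h
    · exact Or.inl (hexp h)
    · rcases addrCmd_writes h with h | h
      · exact Or.inl ⟨_, h⟩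
      · exact Or.inl ⟨_, h⟩
    · exact Or.inl (hexp h)
    · exact h.elim
  | seq c₁ c₂ h₁ h₂ =>
    rcases h with h | h
    · exact (h₁ h).imp_right fun ⟨x, hx, h⟩ => ⟨x, hx, Or.inl h⟩
    · exact (h₂ h).imp_right fun ⟨x, hx, h⟩ => ⟨x, hx, Or.inr h⟩
  | ite e c₁ c₂ h₁ h₂ =>
    rcases h with h | h | h
    · exact Or.inl (hexp h)
    · exact (h₁ h).imp_right fun ⟨x, hx, h⟩ => ⟨x, hx, Or.inl h⟩
    · exact (h₂ h).imp_right fun ⟨x, hx, h⟩ => ⟨x, hx, Or.inr h⟩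
  | loop x c ih =>
    rcases h with h | h
    · exact Or.inr ⟨x, h, Or.inl rfl⟩
    · exact (ih h).imp_right fun ⟨x, hx, h⟩ => ⟨x, hx, Or.inr h⟩

theorem Stmt.compile_loopsOk {c : Stmt} (h : c.LoopsOk) : c.compile.LoopsOk := by
  induction c with
  | assign x e => exact ⟨e.compile_loopsOk 0, trivial, trivial⟩
  | put a e f => exact ⟨e.compile_loopsOk 0, addrCmd_loopsOk a 0, f.compile_loopsOk 1, trivial⟩
  | seq c₁ c₂ h₁ h₂ => exact ⟨h₁ h.1, h₂ h.2⟩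
  | ite e c₁ c₂ h₁ h₂ => exact ⟨e.compile_loopsOk 0, h₁ h.1, h₂ h.2⟩
  | loop x c ih =>
    refine ⟨fun hw => ?_, ih h.2⟩
    rcases Stmt.compile_writes hw with ⟨k, hk⟩ | ⟨y, hy, hyw⟩
    · exact vreg_ne_tmp k x hk
    · exact h.1 (vreg_injective hy ▸ hyw)

theorem Stmt.compile_ok {c : Stmt} (h : c.LoopsOk) : c.compile.Ok := by
  have : ∀ q ≤ 2, ¬ c.compile.Writes q := by
    intro q hq hw
    rcases Stmt.compile_writes hw with ⟨k, hk⟩ | ⟨y, hy, -⟩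
    · have := lt_tmp k
      omega
    · have := lt_vreg y
      omega
  exact ⟨Stmt.compile_loopsOk h, this 0 (by omega), this 1 (by omega)⟩

/-! ### Input and output -/

/-- Compute the address of the arrays. -/
def initCmd : Cmd :=
  .seq (.const 2 1) <| .seq (.add 2 2 0) <| .seq (.add 2 2 0) (.loop (tmp 0) (.add 2 2 0))

theorem initCmd_ok : initCmd.Ok := by
  have := lt_tmp 0
  refine ⟨?_, ?_, ?_⟩ <;> simp [initCmd, Cmd.LoopsOk, Cmd.Writes] <;> omega

/-- Without multiplication, the square is built as `1 + n + n` plus `n` further summands `n`. -/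
theorem initCmd_run (r : Store) :
    (initCmd.run r).mem = r.mem ∧ ∀ q, (initCmd.run r).reg q =
      if q = 2 then (r.reg 0 + 1) * (r.reg 0 + 1) else if q = tmp 0 then 0 else r.reg q := by
  have h4 : tmp 0 = 4 := rfl
  simp only [initCmd, Cmd.run, h4]
  set r₁ := ((r.setReg 2 1).setReg 2 ((r.setReg 2 1).reg 2 + (r.setReg 2 1).reg 0))
  set r₂ := r₁.setReg 2 (r₁.reg 2 + r₁.reg 0) with hr₂
  have hm : r₂.mem = r.mem := rfl
  have hq : ∀ q, r₂.reg q = if q = 2 then 1 + 2 * r.reg 0 else r.reg q := by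
    intro q
    by_cases h : q = 2
    · simp [hr₂, r₁, h]
      omega
    · simp [hr₂, r₁, h]
  have h0 : r₂.reg 0 = r.reg 0 := by simp [hq]
  have := countdown_induction
    (f := fun k (s : Store) => (s.setReg 4 k).setReg 2 ((s.setReg 4 k).reg 2 + (s.setReg 4 k).reg 0))
    (P := fun k s => s.mem = r.mem ∧ ∀ q, s.reg q =
      if q = 2 then 1 + 2 * r.reg 0 + (r.reg 0 - k) * r.reg 0 else if q = 4 then k else r.reg q)
    (N := r₂.reg 0) (s := r₂.setReg 4 (r₂.reg 0)) ⟨rfl, fun q => ?_⟩ ?_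
  · refine ⟨this.1, fun q => ?_⟩
    rw [this.2 q]
    split_ifs
    · simp only [Nat.sub_zero]
      ring
    · rfl
    · rfl
  · simp only [Store.setReg_reg, hq]
    split_ifs <;> simp_all
  · rintro k hk s ⟨h1, h2⟩
    rw [h0] at hk
    refine ⟨h1, fun q => ?_⟩
    simp only [Store.setReg_reg, h2]
    have e : (r.reg 0 - k) * r.reg 0 = (r.reg 0 - (k + 1)) * r.reg 0 + r.reg 0 := by
      rw [show r.reg 0 - k = (r.reg 0 - (k + 1)) + 1 by omega, Nat.succ_mul]
    split_ifs <;> simp_all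
    omega

/-- Write the value of `f` into the memory cell whose address is the value of `e`. -/
def emitCmd (e f : Exp) : Cmd :=
  .seq (e.compile 0) <| .seq (f.compile 1) (.store (tmp 0) (tmp 1))

/-- Cells below `(n + 1) * (n + 1)` hold no array entries, so variables and arrays survive. The
output may overwrite the adjacency matrix, which is why some other matrix `A'` is allowed
afterwards. -/
theorem emitCmd_run {n : ℕ} {A : ℕ → ℕ → ℕ} {s : State} {r : Store} {e f : Exp}
    (hr : Rel n A s r) (he : e.eval n A s < (n + 1) * (n + 1)) :
    (∃ A', Rel n A' s ((emitCmd e f).run r)) ∧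
      ((emitCmd e f).run r).mem = Function.update r.mem (e.eval n A s) (f.eval n A s) := by
  obtain ⟨s1, c1⟩ := e.compile_run (d := 0) hr
  obtain ⟨s2, c2⟩ := f.compile_run (d := 1) (s1.rel hr)
  have h := s2.rel (s1.rel hr)
  have c3 := s2.reg (tmp 0) fun k hk => by rw [Ne, tmp_inj]; omega
  have hm : ((emitCmd e f).run r).mem = Function.update r.mem (e.eval n A s) (f.eval n A s) := by
    simp only [emitCmd, Cmd.run, c2, c3, c1, s2.mem, s1.mem]
  refine ⟨⟨fun i j => ((emitCmd e f).run r).mem (1 + n * i + j), h.size, h.one, h.base, h.var,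
    fun a i => ?_, fun _ _ _ _ => rfl⟩, hm⟩
  rw [hm, Function.update_of_ne (by omega), hr.arr]

/-- Put out the value of `count`, followed by as many pairs of entries of the arrays `fst` and
`snd` as there are vertices. -/
def outputCmd : Cmd :=
  .seq (emitCmd (.num 0) (.var .count)) <| .loop (vreg .i) <|
    .seq (emitCmd (.add (.num 1) (.add (.var .i) (.var .i))) (.get .fst (.var .i)))
      (emitCmd (.add (.num 2) (.add (.var .i) (.var .i))) (.get .snd (.var .i)))

theorem emitCmd_writes {e f : Exp} {q : ℕ} (h : (emitCmd e f).Writes q) : ∃ k, q = tmp k := by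
  rcases h with h | h | h
  · obtain ⟨k, -, h⟩ := Exp.compile_writes h
    exact ⟨k, h⟩
  · obtain ⟨k, -, h⟩ := Exp.compile_writes h
    exact ⟨k, h⟩
  · exact h.elim

theorem emitCmd_loopsOk (e f : Exp) : (emitCmd e f).LoopsOk :=
  ⟨e.compile_loopsOk 0, f.compile_loopsOk 1, trivial⟩

theorem outputCmd_ok : outputCmd.Ok := by
  have hw : ∀ q, outputCmd.Writes q → q = vreg .i ∨ ∃ k, q = tmp k := by
    rintro q (h | h | h | h)
    exacts [.inr (emitCmd_writes h), .inl h, .inr (emitCmd_writes h), .inr (emitCmd_writes h)]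
  have hw' : ∀ q ≤ 2, ¬ outputCmd.Writes q := by
    intro q hq h
    rcases hw q h with h | ⟨k, h⟩
    · have := lt_vreg .i
      omega
    · have := lt_tmp k
      omega
  refine ⟨⟨emitCmd_loopsOk _ _, ?_, emitCmd_loopsOk _ _, emitCmd_loopsOk _ _⟩,
    hw' 0 (by omega), hw' 1 (by omega)⟩
  rintro (h | h) <;> obtain ⟨k, h⟩ := emitCmd_writes h <;> exact vreg_ne_tmp _ _ h

theorem outputCmd_run {n : ℕ} {A : ℕ → ℕ → ℕ} {s : State} {r : Store} (hr : Rel n A s r) :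
    (outputCmd.run r).mem 0 = s.var .count ∧ ∀ k < n,
      (outputCmd.run r).mem (1 + 2 * k) = s.arr .fst k ∧
      (outputCmd.run r).mem (2 + 2 * k) = s.arr .snd k := by
  obtain ⟨⟨A₀, h0⟩, m0⟩ := emitCmd_run (e := .num 0) (f := .var .count) hr (by simp [Exp.eval])
  rw [outputCmd, cmd_run_seq, Cmd.run, h0.size]
  have := countdown_induction
    (f := fun k r => (Cmd.seq
      (emitCmd (.add (.num 1) (.add (.var .i) (.var .i))) (.get .fst (.var .i)))
      (emitCmd (.add (.num 2) (.add (.var .i) (.var .i))) (.get .snd (.var .i)))).run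
        (r.setReg (vreg .i) k))
    (P := fun k r => (∃ A', Rel n A' (s.set .i k) r) ∧ r.mem 0 = s.var .count ∧
      ∀ l < n, k ≤ l → r.mem (1 + 2 * l) = s.arr .fst l ∧ r.mem (2 + 2 * l) = s.arr .snd l)
    (N := n) (s := ((emitCmd (.num 0) (.var .count)).run r).setReg (vreg .i) n)
    ⟨⟨A₀, h0.setVar .i n⟩, by simp [m0, Exp.eval], fun l h1 h2 => by omega⟩ ?_
  · exact ⟨this.2.1, fun k hk => this.2.2 k hk (Nat.zero_le k)⟩
  · rintro k hk t ⟨⟨A', h1⟩, h2, h3⟩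
    -- The addresses written are at most `2 * n`, below the arrays that are still to be read.
    have hb : (n + 1) * (n + 1) = n * n + 2 * n + 1 := by ring
    have h4 := h1.setVar .i k
    rw [show (s.set .i (k + 1)).set .i k = s.set .i k by simp [State.set]] at h4
    obtain ⟨⟨A₁, h5⟩, m5⟩ := emitCmd_run
      (e := .add (.num 1) (.add (.var .i) (.var .i))) (f := .get .fst (.var .i)) h4
      (by simp [Exp.eval]; omega)
    obtain ⟨h6, m6⟩ := emitCmd_run
      (e := .add (.num 2) (.add (.var .i) (.var .i))) (f := .get .snd (.var .i)) h5
      (by simp [Exp.eval]; omega)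
    rw [m5] at m6
    refine ⟨h6, ?_, fun l hl hkl => ?_⟩
    · rw [cmd_run_seq, m6]
      simp only [Exp.eval, State.set_var, if_true, State.set_arr, Function.update_apply,
        Store.setReg_mem]
      rw [if_neg (by omega), if_neg (by omega), h2]
    · rw [cmd_run_seq, m6]
      simp only [Exp.eval, State.set_var, if_true, State.set_arr, Function.update_apply,
        Store.setReg_mem]
      by_cases hlk : l = k
      · subst hlk
        rw [if_neg (by omega), if_pos (by omega), if_pos (by omega)]
        exact ⟨rfl, rfl⟩
      · rw [if_neg (by omega), if_neg (by omega), if_neg (by omega), if_neg (by omega)]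
        exact h3 l hl (by omega)

open Classical in
/-- The adjacency matrix of a graph. -/
noncomputable def adjMatrix {n : ℕ} (G : SimpleGraph (Fin n)) (i j : ℕ) : ℕ :=
  if ∃ (hi : i < n) (hj : j < n), G.Adj ⟨i, hi⟩ ⟨j, hj⟩ then 1 else 0

/-- The state in which all variables and array entries are zero. -/
def State.zero : State := ⟨fun _ => 0, fun _ _ => 0⟩

theorem mul_add_inj {n i j i' j' : ℕ} (hj : j < n) (hj' : j' < n) (h : n * i + j = n * i' + j') :
    i = i' ∧ j = j' := by
  have hn : 0 < n := by omega
  have h1 := congrArg (· / n) h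
  have h2 := congrArg (· % n) h
  simp only [Nat.mul_add_div hn, Nat.mul_add_mod, Nat.div_eq_of_lt hj, Nat.div_eq_of_lt hj',
    Nat.mod_eq_of_lt hj, Nat.mod_eq_of_lt hj'] at h1 h2
  exact ⟨by simpa using h1, h2⟩

/-- All cells behind the matrix are zero in the input, so every array starts out zero. -/
theorem rel_input {n : ℕ} (G : SimpleGraph (Fin n)) :
    Rel n (adjMatrix G) State.zero (initCmd.run ⟨fun r => if r = 0 then (input G).mem 0 else
      if r = 1 then 1 else 0, (input G).mem⟩) := by
  have hn : (input G).mem 0 = n := by simp [input]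
  obtain ⟨hm, hreg⟩ := initCmd_run ⟨fun r => if r = 0 then (input G).mem 0 else
      if r = 1 then 1 else 0, (input G).mem⟩
  have h4 : tmp 0 = 4 := rfl
  rw [hn] at hm hreg ⊢
  refine ⟨by simp [hreg, h4], by simp [hreg, h4], by simp [hreg], fun x => ?_, fun a i => ?_,
    fun i hi j hj => ?_⟩
  · have := lt_vreg x
    rw [hreg, if_neg (by omega), if_neg (vreg_ne_tmp _ _)]
    simp only [State.zero]
    rw [if_neg (by omega), if_neg (by omega)]
  · rw [hm]
    simp only [input, State.zero]
    rw [if_neg (by positivity), if_neg]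
    rintro ⟨p, q, -, h⟩
    have : n * (p : ℕ) ≤ n * n := Nat.mul_le_mul_left n p.2.le
    have hb : (n + 1) * (n + 1) = n * n + 2 * n + 1 := by ring
    have := q.2
    omega
  · rw [hm]
    simp only [input, adjMatrix]
    rw [if_neg (by omega)]
    congr 1
    rw [eq_iff_iff]
    constructor
    · rintro ⟨p, q, hpq, h⟩
      obtain ⟨rfl, rfl⟩ := mul_add_inj hj q.2 (by omega : n * i + j = n * p + q)
      exact ⟨hi, hj, hpq⟩
    · rintro ⟨_, _, h⟩
      exact ⟨_, _, h, rfl⟩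

/-- A statement with well-formed loops gives rise to a program of a random access machine that
halts in polynomial time and puts out the variable `count` and the arrays `fst` and `snd`. -/
theorem Stmt.exists_program {c : Stmt} (hc : c.LoopsOk) :
    ∃ (p : Program) (T : Polynomial ℕ), ∀ (n : ℕ) (G : SimpleGraph (Fin n)),
      ∃ (t : ℕ) (d : Config), t ≤ T.eval n ∧ HaltsIn p t (input G) d ∧
        d.mem 0 = (c.run n (adjMatrix G) State.zero).var .count ∧ ∀ k < n,
          d.mem (1 + 2 * k) = (c.run n (adjMatrix G) State.zero).arr .fst k ∧
          d.mem (2 + 2 * k) = (c.run n (adjMatrix G) State.zero).arr .snd k := by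
  have h1 := initCmd_ok
  have h2 := Stmt.compile_ok hc
  have h3 := outputCmd_ok
  have hok : (Cmd.seq initCmd (.seq c.compile outputCmd)).Ok :=
    ⟨⟨h1.loops, h2.loops, h3.loops⟩, fun h => h.elim h1.zero fun h => h.elim h2.zero h3.zero,
      fun h => h.elim h1.one fun h => h.elim h2.one h3.one⟩
  refine ⟨(Cmd.seq initCmd (.seq c.compile outputCmd)).program, ((Cmd.seq initCmd (.seq c.compile outputCmd)).time + 2), fun n G => ?_⟩
  obtain ⟨t, ht, pc, hh⟩ := Cmd.haltsIn_program hok (m := (input G).mem) rfl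
  rw [show (input G).mem 0 = n by simp [input]] at ht
  obtain ⟨h4, h5⟩ := outputCmd_run (Stmt.compile_run c (rel_input G))
  exact ⟨t, _, ht, hh, h4, h5⟩

end Imp

/-! ## The algorithm -/

namespace Imp

open EOP

namespace Exp

/-- Negation. -/
def not (e : Exp) : Exp := .sub (.num 1) e

/-- Conjunction. -/
def and (e f : Exp) : Exp := .not (.add (.not e) (.not f))

/-- Inequality. -/
def ne (e f : Exp) : Exp := .add (.sub e f) (.sub f e)

/-- Maximum. -/
def max (e f : Exp) : Exp := .add e (.sub f e)

variable {n : ℕ} {A : ℕ → ℕ → ℕ} {s : State}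

theorem eval_not {e : Exp} : e.not.eval n A s = 0 ↔ e.eval n A s ≠ 0 := by
  simp only [not, eval]
  omega

theorem eval_and {e f : Exp} :
    (e.and f).eval n A s = 0 ↔ ¬ (e.eval n A s ≠ 0 ∧ f.eval n A s ≠ 0) := by
  simp only [and, not, eval]
  omega

theorem eval_ne {e f : Exp} : (e.ne f).eval n A s = 0 ↔ e.eval n A s = f.eval n A s := by
  simp only [ne, eval]
  omega

theorem eval_max {e f : Exp} :
    (e.max f).eval n A s = Max.max (e.eval n A s) (f.eval n A s) := by
  simp only [max, eval]
  omega

end Exp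

namespace Stmt

/-- The statement without effect. -/
def skip : Stmt := .assign .pend (.var .pend)

/-- A conditional without alternative. -/
def when (e : Exp) (c : Stmt) : Stmt := .ite e c skip

/-- The statement may change the array `a`. -/
def Puts (a : Arr) : Stmt → Prop
  | assign _ _ => False
  | put b _ _ => a = b
  | seq c₁ c₂ => c₁.Puts a ∨ c₂.Puts a
  | ite _ c₁ c₂ => c₁.Puts a ∨ c₂.Puts a
  | loop _ c => c.Puts a

variable {n : ℕ} {A : ℕ → ℕ → ℕ} {s : State}

@[simp] theorem run_assign {x : Var} {e : Exp} :
    (assign x e).run n A s = s.set x (e.eval n A s) := rfl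

@[simp] theorem run_put {a : Arr} {e f : Exp} :
    (put a e f).run n A s = s.put a (e.eval n A s) (f.eval n A s) := rfl

@[simp] theorem run_seq {c₁ c₂ : Stmt} :
    (seq c₁ c₂).run n A s = c₂.run n A (c₁.run n A s) := rfl

@[simp] theorem run_skip : skip.run n A s = s := by
  simp [skip, Exp.eval, State.set]

theorem run_when {e : Exp} {c : Stmt} :
    (when e c).run n A s = if e.eval n A s = 0 then s else c.run n A s := by
  simp [when, run]

theorem run_var_of_not_writes {x : Var} {c : Stmt} (h : ¬ c.Writes x) (s : State) :
    (c.run n A s).var x = s.var x := by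
  induction c generalizing s with
  | assign y e => simp [show x ≠ y from h]
  | put a e f => rfl
  | seq c₁ c₂ h₁ h₂ =>
    simp only [Writes, not_or] at h
    rw [run, h₂ h.2, h₁ h.1]
  | ite e c₁ c₂ h₁ h₂ =>
    simp only [Writes, not_or] at h
    rw [run]
    split_ifs
    · exact h₂ h.2 s
    · exact h₁ h.1 s
  | loop y c ih =>
    simp only [Writes, not_or] at h
    rw [run]
    refine countdown_induction (P := fun _ (t : State) => t.var x = s.var x) (by simp [h.1]) ?_
    intro k _ t ht
    rw [ih h.2]
    simpa [h.1] using ht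

theorem run_arr_of_not_puts {a : Arr} {c : Stmt} (h : ¬ c.Puts a) (s : State) :
    (c.run n A s).arr a = s.arr a := by
  induction c generalizing s with
  | assign y e => rfl
  | put b e f =>
    funext i
    rw [run_put, State.put_arr, if_neg fun h' => h h'.1]
  | seq c₁ c₂ h₁ h₂ =>
    simp only [Puts, not_or] at h
    rw [run, h₂ h.2, h₁ h.1]
  | ite e c₁ c₂ h₁ h₂ =>
    simp only [Puts, not_or] at h
    rw [run]
    split_ifs
    · exact h₂ h.2 s
    · exact h₁ h.1 s
  | loop y c ih =>
    rw [run]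
    refine countdown_induction (P := fun _ (t : State) => t.arr a = s.arr a) rfl ?_
    intro k _ t ht
    rw [ih h]
    exact ht

end Stmt

/-! ### The program: elimination of vertices, pruning of candidates, listing of edges. -/

open Stmt Exp

/-- Put together a list of statements. -/
local infixr:60 " ;; " => Stmt.seq

/-- Find out whether, among the remaining vertices, `u` has no neighbour other than `w` (variable
`pend`) and whether `u` and `w` have the same neighbours (variable `twin`). -/
def scan : Stmt :=
  assign .pend (num 1) ;; assign .twin (num 1) ;;
  loop .z (
    when (.and (get .alive (var .z)) (.and (adj (var .u) (var .z)) (.ne (var .z) (var .w))))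
      (assign .pend (num 0)) ;;
    when (.and (get .alive (var .z)) (.and (.ne (var .z) (var .u)) (.and (.ne (var .z) (var .w))
        (.ne (adj (var .u) (var .z)) (adj (var .w) (var .z))))))
      (assign .twin (num 0)))

/-- The weight of the label `l` at the vertex `x`. -/
def wt (l : Label) (x : Var) : Exp := get (.weight l) (var x)

/-- Change the weight of the label `l` at the vertex `w`. -/
def setWt (l : Label) (e : Exp) : Stmt := put (.weight l) (var .w) e

/-- Eliminate the isolated vertex `u`. -/
def elimIsolated : Stmt :=
  assign .acc (.add (var .acc) (.max (wt .zero .u) (.max (wt .center .u) (wt .closed .u)))) ;;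
  put .alive (var .u) (num 0)

/-- Eliminate the vertex `u`, whose only neighbour is `w`. -/
def elimPendant : Stmt :=
  setWt .closed (.max (.add (wt .closed .w) (wt .zero .u)) (.add (wt .leaf .w) (wt .center .u))) ;;
  setWt .zero
    (.add (wt .zero .w) (.max (wt .zero .u) (.max (wt .center .u) (wt .closed .u)))) ;;
  setWt .leaf (.add (wt .leaf .w) (wt .zero .u)) ;;
  setWt .center (.add (wt .center .w) (.max (wt .zero .u) (wt .leaf .u))) ;;
  put .alive (var .u) (num 0)

/-- Eliminate the vertex `u`, which is a true twin of `w`. -/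
def elimTwin : Stmt :=
  setWt .closed (.max
    (.max (.add (wt .zero .u) (wt .closed .w)) (.add (wt .closed .u) (wt .zero .w)))
    (.max (.add (wt .leaf .u) (wt .center .w)) (.add (wt .center .u) (wt .leaf .w)))) ;;
  setWt .leaf (.max (.add (wt .zero .u) (wt .leaf .w)) (.add (wt .leaf .u) (wt .zero .w))) ;;
  setWt .center
    (.max (.add (wt .zero .u) (wt .center .w)) (.add (wt .center .u) (wt .zero .w))) ;;
  setWt .zero (.add (wt .zero .u) (wt .zero .w)) ;;
  put .alive (var .u) (num 0)

/-- Eliminate the vertex `u` by means of the vertex `w`, if this is possible. -/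
def tryElim : Stmt :=
  scan ;;
  when (get .alive (var .u)) (
    ite (.ne (var .u) (var .w))
      (when (.and (get .alive (var .w)) (adj (var .u) (var .w)))
        (ite (var .pend) elimPendant (when (var .twin) elimTwin)))
      (when (var .pend) elimIsolated))

/-- Compute, in the variable `acc`, the largest size of an edge open packing set that covers only
vertices of the set `alive`. -/
def solve : Stmt :=
  assign .acc (num 0) ;;
  loop .z (put (.weight .zero) (var .z) (num 0) ;; put (.weight .leaf) (var .z) (num 1) ;;
    put (.weight .center) (var .z) (num 0) ;; put (.weight .closed) (var .z) (num 0)) ;;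
  loop .t (loop .u (loop .w tryElim))

/-- Copy the array `cand` to the array `alive`. -/
def copyCand : Stmt := loop .z (put .alive (var .z) (get .cand (var .z)))

/-- Take all vertices as candidates and compute the optimum. -/
def prepare : Stmt :=
  loop .z (put .cand (var .z) (num 1)) ;; copyCand ;; solve ;; assign .best (var .acc)

/-- Remove the vertices that can be spared from the candidates. -/
def prune : Stmt :=
  loop .v (when (get .cand (var .v)) (
    copyCand ;; put .alive (var .v) (num 0) ;; solve ;;
    when (.not (.ne (var .acc) (var .best))) (put .cand (var .v) (num 0))))

/-- List the edges between the candidates. -/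
def listEdges : Stmt :=
  assign .count (num 0) ;;
  loop .i (loop .j (
    when (.and (get .cand (var .i)) (.and (get .cand (var .j))
        (.and (adj (var .i) (var .j)) (.sub (var .j) (var .i)))))
      (put .fst (var .count) (var .i) ;; put .snd (var .count) (var .j) ;;
        assign .count (.add (var .count) (num 1)))))

/-- Remove vertices from the set of all vertices as long as the optimum stays the same, and list
the edges between the vertices that are left. -/
def algorithm : Stmt := prepare ;; prune ;; listEdges

theorem algorithm_loopsOk : algorithm.LoopsOk := by
  simp [algorithm, prepare, prune, listEdges, copyCand, solve, tryElim, scan, elimIsolated, elimPendant, elimTwin, setWt,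
    when, skip, LoopsOk, Writes]

/-! ### Correctness of the elimination. -/

/-- The vertices whose entries in the array `a` are nonzero. -/
def State.vertices (n : ℕ) (s : State) (a : Arr) : Finset (Fin n) :=
  Finset.univ.filter fun x => s.arr a x ≠ 0

/-- The weights of the labels. -/
def State.weights (n : ℕ) (s : State) (l : Label) (x : Fin n) : ℕ := s.arr (.weight l) x

variable {n : ℕ} {G : SimpleGraph (Fin n)} {s : State}

theorem State.mem_vertices {a : Arr} {x : Fin n} : x ∈ s.vertices n a ↔ s.arr a x ≠ 0 := by
  simp [State.vertices]

open Classical in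
theorem adjMatrix_fin (x y : Fin n) : adjMatrix G x y = if G.Adj x y then 1 else 0 := by
  simp [adjMatrix]

open Classical in
theorem eval_adj {x y : Var} {a b : Fin n} (hx : s.var x = a) (hy : s.var y = b) :
    (Exp.adj (.var x) (.var y)).eval n (adjMatrix G) s = if G.Adj a b then 1 else 0 := by
  simp [eval, hx, hy, adjMatrix_fin]

/-- Each flag stays nonzero as long as no vertex scanned so far is a counterexample. For `u = w` the
first condition says that `u` is isolated, as no vertex is its own neighbour. -/
theorem scan_run {u w : Fin n} (hu : s.var .u = u) (hw : s.var .w = w) :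
    (scan.run n (adjMatrix G) s).arr = s.arr ∧
    ((scan.run n (adjMatrix G) s).var .pend ≠ 0 ↔
      ∀ z ∈ s.vertices n .alive, G.Adj u z → z = w) ∧
    ((scan.run n (adjMatrix G) s).var .twin ≠ 0 ↔
      ∀ z ∈ s.vertices n .alive, z ≠ u → z ≠ w → (G.Adj u z ↔ G.Adj w z)) := by
  have := countdown_induction
    (f := fun k t => (
      when (.and (get .alive (var .z)) (.and (adj (var .u) (var .z)) (.ne (var .z) (var .w))))
        (assign .pend (num 0)) ;;
      when (.and (get .alive (var .z)) (.and (.ne (var .z) (var .u)) (.and (.ne (var .z) (var .w))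
        (.ne (adj (var .u) (var .z)) (adj (var .w) (var .z))))))
        (assign .twin (num 0))).run n (adjMatrix G) (t.set .z k))
    (P := fun k t => t.arr = s.arr ∧ t.var .u = u ∧ t.var .w = w ∧
      (t.var .pend ≠ 0 ↔ ∀ z ∈ s.vertices n .alive, k ≤ (z : ℕ) → G.Adj u z → z = w) ∧
      (t.var .twin ≠ 0 ↔ ∀ z ∈ s.vertices n .alive, k ≤ (z : ℕ) → z ≠ u → z ≠ w →
        (G.Adj u z ↔ G.Adj w z)))
    (N := n) (s := ((s.set .pend 1).set .twin 1).set .z n)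
    ⟨rfl, by simp [hu], by simp [hw],
      by simp,
      by simp⟩ ?_
  · obtain ⟨h1, -, -, h2, h3⟩ := this
    refine ⟨h1, h2.trans ?_, h3.trans ?_⟩ <;> simp
  · rintro k hk t ⟨h1, h2, h3, h4, h5⟩
    obtain ⟨z, rfl⟩ : ∃ z : Fin n, (z : ℕ) = k := ⟨⟨k, hk⟩, rfl⟩
    have hsplit : ∀ x : Fin n, (z : ℕ) ≤ x ↔ x = z ∨ (z : ℕ) + 1 ≤ x := fun x => by
      rw [Fin.ext_iff]
      omega
    classical
    have c1 : ∀ r : State, r.arr = s.arr → r.var .u = u → r.var .w = w → r.var .z = z →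
        ((Exp.and (get .alive (var .z)) (.and (adj (var .u) (var .z)) (.ne (var .z) (var .w)))).eval
          n (adjMatrix G) r = 0 ↔ (z ∈ s.vertices n .alive → G.Adj u z → z = w)) := by
      intro r h1 h2 h3 h4
      simp only [ne_eq, eval_and, eval_ne, eval_adj h2 h4, State.mem_vertices]
      simp [eval, h1, h3, h4, Fin.ext_iff]
    have c2 : ∀ r : State, r.arr = s.arr → r.var .u = u → r.var .w = w → r.var .z = z →
        ((Exp.and (get .alive (var .z)) (.and (.ne (var .z) (var .u)) (.and (.ne (var .z) (var .w))
          (.ne (adj (var .u) (var .z)) (adj (var .w) (var .z)))))).eval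
          n (adjMatrix G) r = 0 ↔ (z ∈ s.vertices n .alive → z ≠ u → z ≠ w →
            (G.Adj u z ↔ G.Adj w z))) := by
      intro r h1 h2 h3 h4
      simp only [ne_eq, eval_and, eval_ne, eval_adj h2 h4, eval_adj h3 h4, State.mem_vertices]
      have : ((if G.Adj u z then 1 else 0) = if G.Adj w z then 1 else 0) ↔
          (G.Adj u z ↔ G.Adj w z) := by
        split_ifs <;> simp_all
      simp only [eval, h1, h2, h3, h4, this, Fin.ext_iff]
      tauto
    have sp : (∀ x ∈ s.vertices n .alive, (z : ℕ) ≤ x → G.Adj u x → x = w) ↔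
        (z ∈ s.vertices n .alive → G.Adj u z → z = w) ∧
        (∀ x ∈ s.vertices n .alive, (z : ℕ) + 1 ≤ x → G.Adj u x → x = w) := by
      simp only [hsplit]
      exact ⟨fun h => ⟨fun h' => h z h' (.inl rfl), fun x hx hz => h x hx (.inr hz)⟩,
        fun h x hx hz => hz.elim (fun e => e ▸ h.1 (e ▸ hx)) (h.2 x hx)⟩
    have st : (∀ x ∈ s.vertices n .alive, (z : ℕ) ≤ x → x ≠ u → x ≠ w →
          (G.Adj u x ↔ G.Adj w x)) ↔
        (z ∈ s.vertices n .alive → z ≠ u → z ≠ w → (G.Adj u z ↔ G.Adj w z)) ∧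
        (∀ x ∈ s.vertices n .alive, (z : ℕ) + 1 ≤ x → x ≠ u → x ≠ w →
          (G.Adj u x ↔ G.Adj w x)) := by
      simp only [hsplit]
      exact ⟨fun h => ⟨fun h' => h z h' (.inl rfl), fun x hx hz => h x hx (.inr hz)⟩,
        fun h x hx hz => hz.elim (fun e => e ▸ h.1 (e ▸ hx)) (h.2 x hx)⟩
    rw [sp, st, run_seq]
    obtain ⟨r, hr, r1, r2, r3, r4, r5, r6⟩ : ∃ r : State, (when (.and (get .alive (var .z))
        (.and (adj (var .u) (var .z)) (.ne (var .z) (var .w)))) (assign .pend (num 0))).run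
          n (adjMatrix G) (t.set .z z) = r ∧ r.arr = s.arr ∧ r.var .u = u ∧ r.var .w = w ∧
        r.var .z = z ∧ (r.var .pend ≠ 0 ↔ (z ∈ s.vertices n .alive → G.Adj u z → z = w) ∧
          t.var .pend ≠ 0) ∧ r.var .twin = t.var .twin := by
      refine ⟨_, rfl, ?_⟩
      have := c1 (t.set .z z) h1 (by simp [h2]) (by simp [h3]) (by simp)
      rw [run_when]
      split_ifs with h
      · exact ⟨h1, by simp [h2], by simp [h3], by simp, by rw [and_iff_right (this.1 h)]; simp,
          by simp⟩
      · rw [this] at h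
        exact ⟨h1, by simp [h2], by simp [h3], by simp, by simp [h, eval], by simp⟩
    rw [hr, run_when]
    have := c2 r r1 r2 r3 r4
    split_ifs with h
    · exact ⟨r1, r2, r3, by rw [r5, h4], by rw [r6, h5, and_iff_right (this.1 h)]⟩
    · rw [this] at h
      exact ⟨r1, by simp [r2], by simp [r3], by simp [r5, h4], by simp [h, eval]⟩

theorem vertices_put_zero {a : Arr} {u : Fin n} :
    (s.put a u 0).vertices n a = (s.vertices n a).erase u := by
  ext x
  simp [State.mem_vertices, Fin.ext_iff]

theorem vertices_congr {s' : State} {a : Arr} (h : s'.arr a = s.arr a) :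
    s'.vertices n a = s.vertices n a := by
  simp [State.vertices, h]

/-- The largest weight of a labeling, as a property of a state. -/
def State.Attains (G : SimpleGraph (Fin n)) (s : State) (m : ℕ) : Prop :=
  EOP.Attains G (s.vertices n .alive) (s.weights n) (s.var .acc) m

theorem elimIsolated_run {u : Fin n} (hu : s.var .u = u) (hua : u ∈ s.vertices n .alive)
    (h : ∀ z ∈ s.vertices n .alive, ¬ G.Adj u z) :
    (elimIsolated.run n (adjMatrix G) s).vertices n .alive = (s.vertices n .alive).erase u ∧
      ∀ m, (elimIsolated.run n (adjMatrix G) s).Attains G m ↔ s.Attains G m := by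
  have h1 : (elimIsolated.run n (adjMatrix G) s).vertices n .alive =
      (s.vertices n .alive).erase u := by
    simp only [elimIsolated, run_seq, run_assign, run_put, eval, State.set_var, reduceCtorEq,
      if_false, hu, vertices_put_zero]
    rfl
  refine ⟨h1, fun m => ?_⟩
  rw [State.Attains, State.Attains, attains_isolated hua h, h1]
  have h2 : (elimIsolated.run n (adjMatrix G) s).weights n = s.weights n := by
    funext l x
    simp [elimIsolated, State.weights]
  have h3 : (elimIsolated.run n (adjMatrix G) s).var .acc = s.var .acc +
      max (s.weights n .zero u) (max (s.weights n .center u) (s.weights n .closed u)) := by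
    simp [elimIsolated, State.weights, eval, eval_max, wt, hu]
  rw [h2, h3]

/-- The weights are overwritten one by one, `closed` first, since it needs the old `leaf` weight of
`w`. The other updates read, at `w`, only the weight they replace. -/
theorem elimPendant_run {u w : Fin n} (hu : s.var .u = u) (hw : s.var .w = w)
    (hua : u ∈ s.vertices n .alive) (hwa : w ∈ s.vertices n .alive) (huw : G.Adj u w)
    (h : ∀ z ∈ s.vertices n .alive, G.Adj u z → z = w) :
    (elimPendant.run n (adjMatrix G) s).vertices n .alive = (s.vertices n .alive).erase u ∧
      ∀ m, (elimPendant.run n (adjMatrix G) s).Attains G m ↔ s.Attains G m := by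
  have hne : (u : ℕ) ≠ w := fun h => huw.ne (Fin.ext h)
  have h1 : (elimPendant.run n (adjMatrix G) s).vertices n .alive =
      (s.vertices n .alive).erase u := by
    simp only [elimPendant, run_seq, run_put, setWt, eval, State.put_var, hu, vertices_put_zero]
    congr 1
  refine ⟨h1, fun m => ?_⟩
  have h3 : (elimPendant.run n (adjMatrix G) s).var .acc = s.var .acc := by
    simp [elimPendant, setWt]
  rw [State.Attains, State.Attains, h1, h3]
  refine (attains_pendant hua hwa huw h ?_ ?_ ?_ ?_ ?_).symm
  · intro l v hv
    have hv' : (v : ℕ) ≠ w := fun h => hv (Fin.ext h)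
    simp [elimPendant, setWt, State.weights, eval, hw, hv']
  all_goals
    simp [elimPendant, setWt, wt, State.weights, eval, eval_max, hu, hw, hne]

/-- The order matters: `closed` reads all four old weights of `w` and comes first; `leaf` and
`center` read the old `zero` weight, which is changed last. -/
theorem elimTwin_run {u w : Fin n} (hu : s.var .u = u) (hw : s.var .w = w)
    (hua : u ∈ s.vertices n .alive) (hwa : w ∈ s.vertices n .alive) (huw : G.Adj u w)
    (h : ∀ z ∈ s.vertices n .alive, z ≠ u → z ≠ w → (G.Adj u z ↔ G.Adj w z)) :
    (elimTwin.run n (adjMatrix G) s).vertices n .alive = (s.vertices n .alive).erase u ∧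
      ∀ m, (elimTwin.run n (adjMatrix G) s).Attains G m ↔ s.Attains G m := by
  have hne : (u : ℕ) ≠ w := fun h => huw.ne (Fin.ext h)
  have h1 : (elimTwin.run n (adjMatrix G) s).vertices n .alive =
      (s.vertices n .alive).erase u := by
    simp only [elimTwin, run_seq, run_put, setWt, eval, State.put_var, hu, vertices_put_zero]
    congr 1
  refine ⟨h1, fun m => ?_⟩
  have h3 : (elimTwin.run n (adjMatrix G) s).var .acc = s.var .acc := by
    simp [elimTwin, setWt]
  rw [State.Attains, State.Attains, h1, h3]
  refine (attains_twin hua hwa huw h ?_ ?_ ?_ ?_ ?_).symm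
  · intro l v hv
    have hv' : (v : ℕ) ≠ w := fun h => hv (Fin.ext h)
    simp [elimTwin, setWt, State.weights, eval, hw, hv']
  all_goals
    simp [elimTwin, setWt, wt, State.weights, eval, eval_max, hu, hw, hne]

/-- Within `U`, the vertex `u` can be eliminated by means of `w`. -/
def Eliminable (G : SimpleGraph (Fin n)) (U : Finset (Fin n)) (u w : Fin n) : Prop :=
  u ∈ U ∧ ((u = w ∧ ∀ z ∈ U, ¬ G.Adj u z) ∨ (w ∈ U ∧ G.Adj u w ∧
    ((∀ z ∈ U, G.Adj u z → z = w) ∨ ∀ z ∈ U, z ≠ u → z ≠ w → (G.Adj u z ↔ G.Adj w z))))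

/-- The state `s'` arises from `s` by the elimination of vertices. -/
structure Reduces (G : SimpleGraph (Fin n)) (s s' : State) : Prop where
  subset : s'.vertices n .alive ⊆ s.vertices n .alive
  attains : ∀ m, s'.Attains G m ↔ s.Attains G m

theorem Reduces.trans {s₁ s₂ s₃ : State} (h : Reduces G s₁ s₂) (h' : Reduces G s₂ s₃) :
    Reduces G s₁ s₃ :=
  ⟨h'.subset.trans h.subset, fun m => (h'.attains m).trans (h.attains m)⟩

theorem Reduces.of_eq {s' : State} (ha : s'.arr = s.arr) (hacc : s'.var .acc = s.var .acc) :
    Reduces G s s' := by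
  have h := vertices_congr (n := n) (congrFun ha .alive)
  refine ⟨h.subset, fun m => ?_⟩
  have hw : s'.weights n = s.weights n := by
    funext l x
    simp [State.weights, ha]
  rw [State.Attains, State.Attains, h, hw, hacc]

/-- Every successful test takes `u` out of the remaining vertices, so an unchanged set certifies
that the tests failed. -/
theorem tryElim_run {u w : Fin n} (hu : s.var .u = u) (hw : s.var .w = w) :
    Reduces G s (tryElim.run n (adjMatrix G) s) ∧
      ((tryElim.run n (adjMatrix G) s).vertices n .alive = s.vertices n .alive →
        ¬ Eliminable G (s.vertices n .alive) u w) := by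
  obtain ⟨harr, hpend, htwin⟩ := scan_run (G := G) hu hw
  have hu' := (run_var_of_not_writes (n := n) (A := adjMatrix G) (c := scan) (x := .u)
    (by simp [scan, Writes, when, skip]) s).trans hu
  have hw' := (run_var_of_not_writes (n := n) (A := adjMatrix G) (c := scan) (x := .w)
    (by simp [scan, Writes, when, skip]) s).trans hw
  have hacc := run_var_of_not_writes (n := n) (A := adjMatrix G) (c := scan) (x := .acc)
    (by simp [scan, Writes, when, skip]) s
  rw [tryElim, run_seq]
  set r := scan.run n (adjMatrix G) s
  have hsr : Reduces G s r := Reduces.of_eq harr hacc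
  have hv : r.vertices n .alive = s.vertices n .alive := vertices_congr (congrFun harr .alive)
  have hsub : ∀ r' : State, r'.vertices n .alive = (r.vertices n .alive).erase u ∧
      (∀ m, r'.Attains G m ↔ r.Attains G m) → u ∈ s.vertices n .alive → Reduces G s r' ∧
      (r'.vertices n .alive = s.vertices n .alive →
        ¬ Eliminable G (s.vertices n .alive) u w) := by
    rintro r' ⟨h1, h2⟩ hus
    refine ⟨hsr.trans ⟨h1 ▸ Finset.erase_subset _ _, h2⟩, fun h => ?_⟩
    rw [← h, h1] at hus
    exact absurd hus (Finset.notMem_erase _ _)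
  rw [← hv] at hpend htwin hsub ⊢
  rw [run_when]
  by_cases h1 : u ∈ r.vertices n .alive
  · have e1 : (get .alive (var .u)).eval n (adjMatrix G) r ≠ 0 := by
      rw [State.mem_vertices] at h1
      simpa [eval, hu'] using h1
    rw [if_neg e1, run]
    simp only [eval_ne]
    by_cases huw : u = w
    · have e2 : (var .u).eval n (adjMatrix G) r = (var .w).eval n (adjMatrix G) r := by
        simp [eval, hu', hw', huw]
      rw [if_pos e2, run_when]
      by_cases hp : r.var .pend = 0
      · rw [eval, if_pos hp]
        refine ⟨hsr, fun _ ⟨_, h⟩ => ?_⟩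
        rcases h with ⟨-, h⟩ | ⟨-, h, -⟩
        · exact hpend.2 (fun z hz hadj => absurd hadj (h z hz)) hp
        · exact h.ne huw
      · rw [eval, if_neg hp]
        rw [← ne_eq, hpend] at hp
        refine hsub _ (elimIsolated_run hu' h1 fun z hz huz => ?_) h1
        exact huz.ne (huw.trans (hp z hz huz).symm)
    · have e2 : ¬ (var .u).eval n (adjMatrix G) r = (var .w).eval n (adjMatrix G) r := by
        simpa [eval, hu', hw', Fin.ext_iff] using huw
      rw [if_neg e2, run_when]
      classical
      have e3 : (Exp.and (get .alive (var .w)) (adj (var .u) (var .w))).eval n (adjMatrix G) r = 0 ↔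
          ¬ (w ∈ r.vertices n .alive ∧ G.Adj u w) := by
        simp only [ne_eq, eval_and, eval_adj hu' hw', State.mem_vertices]
        simp [eval, hw']
      split_ifs with h2 <;> rw [e3] at h2
      · exact ⟨hsr, fun _ ⟨_, h⟩ => h.elim (fun h => huw h.1) fun h => h2 ⟨h.1, h.2.1⟩⟩
      · rw [not_not] at h2
        rw [run, eval]
        split_ifs with hp
        · rw [run_when, eval]
          split_ifs with ht
          · refine ⟨hsr, fun _ ⟨_, h⟩ => ?_⟩
            rcases h with ⟨h, -⟩ | ⟨-, -, h | h⟩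
            · exact huw h
            · exact hpend.2 h hp
            · exact htwin.2 h ht
          · exact hsub _ (elimTwin_run hu' hw' h1 h2.1 h2.2 (htwin.1 ht)) h1
        · exact hsub _ (elimPendant_run hu' hw' h1 h2.1 h2.2 (hpend.1 hp)) h1
  · have e1 : (get .alive (var .u)).eval n (adjMatrix G) r = 0 := by
      rw [State.mem_vertices, not_not] at h1
      simpa [eval, hu'] using h1
    rw [if_pos e1]
    exact ⟨hsr, fun _ h => h1 h.1⟩

theorem tryElim_run_var {x : Var} (h : x = .u ∨ x = .w ∨ x = .t) (s : State) :
    (tryElim.run n (adjMatrix G) s).var x = s.var x := by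
  apply run_var_of_not_writes
  rcases h with rfl | rfl | rfl <;>
    simp [tryElim, scan, elimIsolated, elimPendant, elimTwin, setWt, when, skip, Writes]

theorem loop_tryElim_run {u : Fin n} (hu : s.var .u = u) :
    Reduces G s ((loop .w tryElim).run n (adjMatrix G) s) ∧
      (((loop .w tryElim).run n (adjMatrix G) s).vertices n .alive = s.vertices n .alive →
        ∀ w, ¬ Eliminable G (s.vertices n .alive) u w) := by
  rw [run]
  have := countdown_induction
    (f := fun k t => tryElim.run n (adjMatrix G) (t.set .w k))
    (P := fun k t => t.var .u = u ∧ Reduces G s t ∧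
      (t.vertices n .alive = s.vertices n .alive → ∀ w : Fin n, k ≤ (w : ℕ) →
        ¬ Eliminable G (s.vertices n .alive) u w))
    (N := n) (s := s.set .w n)
    ⟨by simpa using hu, Reduces.of_eq rfl (by simp), fun _ w h => absurd w.2 (not_lt.2 h)⟩ ?_
  · exact ⟨this.2.1, fun h w => this.2.2 h w (Nat.zero_le _)⟩
  · rintro k hk t ⟨h1, h2, h3⟩
    have h4 : Reduces G s (t.set .w k) := h2.trans (Reduces.of_eq rfl (by simp))
    have h1' : (t.set .w k).var .u = u := by simpa using h1
    obtain ⟨h5, h6⟩ := tryElim_run (G := G) (w := ⟨k, hk⟩) h1' (by simp)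
    refine ⟨(tryElim_run_var (by simp) _).trans h1', h4.trans h5, fun heq w hw => ?_⟩
    -- The set only shrinks, so equality at the end forces equality at each earlier moment: all
    -- tests concerned the same set.
    have h7 : (t.set .w k).vertices n .alive = s.vertices n .alive :=
      h4.subset.antisymm (heq ▸ h5.subset)
    rcases hw.eq_or_lt with hw | hw
    · have : w = ⟨k, hk⟩ := Fin.ext hw.symm
      rw [this, ← h7]
      exact h6 (heq.trans h7.symm)
    · exact h3 h7 w hw

/-- All pairs are tried in a round. If nothing is removed, `IsBlockGraph.exists_eliminable` leaves
only the empty set. -/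
theorem round_run (hG : IsBlockGraph G) :
    Reduces G s ((loop .u (loop .w tryElim)).run n (adjMatrix G) s) ∧
      (((loop .u (loop .w tryElim)).run n (adjMatrix G) s).vertices n .alive =
        s.vertices n .alive → s.vertices n .alive = ∅) := by
  rw [run]
  have := countdown_induction
    (f := fun k t => (loop .w tryElim).run n (adjMatrix G) (t.set .u k))
    (P := fun k t => Reduces G s t ∧
      (t.vertices n .alive = s.vertices n .alive → ∀ u : Fin n, k ≤ (u : ℕ) → ∀ w,
        ¬ Eliminable G (s.vertices n .alive) u w))
    (N := n) (s := s.set .u n)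
    ⟨Reduces.of_eq rfl (by simp), fun _ u h => absurd u.2 (not_lt.2 h)⟩ ?_
  · refine ⟨this.1, fun h => ?_⟩
    by_contra hne
    obtain ⟨u, hu, hw⟩ := hG.exists_eliminable (Finset.nonempty_iff_ne_empty.2 hne)
    -- An isolated vertex is tried with itself as partner.
    rcases hw with hw | ⟨w, hw⟩
    · exact this.2 h u (Nat.zero_le _) u ⟨hu, Or.inl ⟨rfl, hw⟩⟩
    · exact this.2 h u (Nat.zero_le _) w ⟨hu, Or.inr hw⟩
  · rintro k hk t ⟨h2, h3⟩
    have h4 : Reduces G s (t.set .u k) := h2.trans (Reduces.of_eq rfl (by simp))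
    obtain ⟨h5, h6⟩ := loop_tryElim_run (G := G) (u := ⟨k, hk⟩) (s := t.set .u k) (by simp)
    refine ⟨h4.trans h5, fun heq u hu => ?_⟩
    have h7 : (t.set .u k).vertices n .alive = s.vertices n .alive :=
      h4.subset.antisymm (heq ▸ h5.subset)
    rcases hu.eq_or_lt with hu | hu
    · have : u = ⟨k, hk⟩ := Fin.ext hu.symm
      rw [this, ← h7]
      exact h6 (heq.trans h7.symm)
    · exact h3 h7 u hu

/-- The weights and `acc` are reset at the start, so nothing is required of `s` and the computation
can be repeated during pruning. Once no vertices are left, the optimum is `acc`. -/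
theorem solve_run (hG : IsBlockGraph G) (m : ℕ) :
    m ≤ (solve.run n (adjMatrix G) s).var .acc ↔ HasPacking G (s.vertices n .alive) m := by
  rw [solve, run_seq, run_seq]
  set r := (loop .z (put (.weight .zero) (var .z) (num 0) ;; put (.weight .leaf) (var .z) (num 1) ;;
    put (.weight .center) (var .z) (num 0) ;; put (.weight .closed) (var .z) (num 0))).run n
      (adjMatrix G) ((assign .acc (num 0)).run n (adjMatrix G) s) with hr
  have hacc : r.var .acc = 0 := by
    rw [hr, run_var_of_not_writes (by simp [Writes])]
    simp [eval]
  have halive : r.vertices n .alive = s.vertices n .alive := by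
    rw [hr]
    refine vertices_congr ?_
    rw [run_arr_of_not_puts (by simp [Puts])]
    rfl
  have hwt : r.weights n = leafWeight := by
    have := countdown_induction
      (f := fun k t => (put (.weight .zero) (var .z) (num 0) ;;
        put (.weight .leaf) (var .z) (num 1) ;; put (.weight .center) (var .z) (num 0) ;;
        put (.weight .closed) (var .z) (num 0)).run n (adjMatrix G) (t.set .z k))
      (P := fun k (t : State) => ∀ l, ∀ i < n, k ≤ i →
        t.arr (.weight l) i = if l = .leaf then 1 else 0)
      (N := n) (s := (s.set .acc 0).set .z n) (fun l i h1 h2 => by omega) (fun k hk t h l i h1 h2 => by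
        by_cases hik : i = k
        · cases l <;> simp [eval, hik]
        · have := h l i h1 (by omega)
          cases l <;> simp_all [eval])
    funext l x
    exact this l x x.2 (Nat.zero_le _)
  have hatt : r.Attains G m ↔ HasPacking G (s.vertices n .alive) m := by
    rw [State.Attains, hacc, halive, hwt, attains_leafWeight_iff]
  rw [← hatt, run]
  -- With `k` rounds to go at most `k` vertices remain, since each round removes a vertex unless
  -- none is left.
  obtain ⟨h1, h2⟩ := countdown_induction
    (f := fun k t => (loop .u (loop .w tryElim)).run n (adjMatrix G) (t.set .t k))
    (P := fun k t => Reduces G r t ∧ (t.vertices n .alive).card ≤ k)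
    (N := n) (s := r.set .t n)
    ⟨Reduces.of_eq rfl (by simp), (Finset.card_le_univ _).trans (by simp)⟩ (by
      rintro k hk t ⟨h2, h3⟩
      have h4 : Reduces G t (t.set .t k) := Reduces.of_eq rfl (by simp)
      obtain ⟨h5, h6⟩ := round_run (s := t.set .t k) hG
      refine ⟨(h2.trans h4).trans h5, ?_⟩
      have h7 := Finset.card_le_card h4.subset
      by_cases heq : ((loop .u (loop .w tryElim)).run n (adjMatrix G) (t.set .t k)).vertices n
          .alive = (t.set .t k).vertices n .alive
      · rw [heq, h6 heq]
        simp
      · have := Finset.card_lt_card (h5.subset.ssubset_of_ne heq)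
        omega)
  rw [← h1.attains, State.Attains, Finset.card_eq_zero.1 (Nat.le_zero.1 h2), attains_empty]

theorem copyCand_run :
    (copyCand.run n (adjMatrix G) s).vertices n .alive = s.vertices n .cand := by
  have := countdown_induction
    (f := fun k t => (put .alive (var .z) (get .cand (var .z))).run n (adjMatrix G) (t.set .z k))
    (P := fun k (t : State) => t.arr .cand = s.arr .cand ∧
      ∀ i < n, k ≤ i → t.arr .alive i = s.arr .cand i)
    (N := n) (s := s.set .z n) ⟨rfl, fun i h1 h2 => by omega⟩ (by
      rintro k hk t ⟨h1, h2⟩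
      refine ⟨?_, fun i hi hki => ?_⟩
      · rw [run_arr_of_not_puts (by simp [Puts])]
        exact h1
      · by_cases hik : i = k
        · simp [eval, hik, h1]
        · simpa [eval, hik] using h2 i hi (by omega))
  ext x
  rw [State.mem_vertices, State.mem_vertices, copyCand, run, this.2 x x.2 (Nat.zero_le _)]

theorem solve_run_arr {a : Arr} (h : a = .cand ∨ a = .fst ∨ a = .snd) (s : State) :
    (solve.run n (adjMatrix G) s).arr a = s.arr a := by
  apply run_arr_of_not_puts
  rcases h with rfl | rfl | rfl <;>
    simp [solve, tryElim, scan, elimIsolated, elimPendant, elimTwin, setWt, when, skip, Puts]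

theorem solve_run_var {x : Var} (h : x = .v ∨ x = .best) (s : State) :
    (solve.run n (adjMatrix G) s).var x = s.var x := by
  apply run_var_of_not_writes
  rcases h with rfl | rfl <;>
    simp [solve, tryElim, scan, elimIsolated, elimPendant, elimTwin, setWt, when, skip, Writes]

theorem prepare_run (hG : IsBlockGraph G) :
    (prepare.run n (adjMatrix G) s).vertices n .cand = Finset.univ ∧
      (prepare.run n (adjMatrix G) s).var .best = edgeOpenPackingNumber G := by
  rw [prepare, run_seq, run_seq, run_seq]
  set r := (loop .z (put .cand (var .z) (num 1))).run n (adjMatrix G) s with hr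
  have h1 : r.vertices n .cand = Finset.univ := by
    have := countdown_induction
      (f := fun k t => (put .cand (var .z) (num 1)).run n (adjMatrix G) (t.set .z k))
      (P := fun k (t : State) => ∀ i < n, k ≤ i → t.arr .cand i = 1)
      (N := n) (s := s.set .z n) (fun i h1 h2 => by omega) (fun k hk t h i h1 h2 => by
        by_cases hik : i = k
        · simp [eval, hik]
        · simpa [eval, hik] using h i h1 (by omega))
    ext x
    rw [State.mem_vertices, hr, run, this x x.2 (Nat.zero_le _)]
    simp
  have h2 : ∀ m, m ≤ (solve.run n (adjMatrix G) (copyCand.run n (adjMatrix G) r)).var .acc ↔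
      m ≤ edgeOpenPackingNumber G := fun m => by
    rw [solve_run hG, copyCand_run, h1, hasPacking_univ_iff]
  refine ⟨?_, ?_⟩
  · rw [← h1]
    refine vertices_congr ?_
    rw [run_assign, State.set_arr, solve_run_arr (by simp), copyCand,
      run_arr_of_not_puts (by simp [Puts])]
  · rw [run_assign, State.set_var, if_pos rfl]
    exact le_antisymm ((h2 _).1 le_rfl) ((h2 _).2 le_rfl)

/-- One pass suffices: a vertex that cannot be spared from a set cannot be spared from a smaller one
either, because packings in the smaller set are packings in the larger. -/
theorem prune_run (hG : IsBlockGraph G) (hcand : s.vertices n .cand = Finset.univ)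
    (hbest : s.var .best = edgeOpenPackingNumber G) :
    HasPacking G ((prune.run n (adjMatrix G) s).vertices n .cand) (edgeOpenPackingNumber G) ∧
      ∀ v ∈ (prune.run n (adjMatrix G) s).vertices n .cand,
        ¬ HasPacking G (((prune.run n (adjMatrix G) s).vertices n .cand).erase v)
          (edgeOpenPackingNumber G) := by
  rw [prune, run]
  have := countdown_induction
    (f := fun k t => (when (get .cand (var .v)) (
      copyCand ;; put .alive (var .v) (num 0) ;; solve ;;
      when (.not (.ne (var .acc) (var .best))) (put .cand (var .v) (num 0)))).run n
        (adjMatrix G) (t.set .v k))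
    (P := fun k (t : State) => t.var .best = edgeOpenPackingNumber G ∧
      HasPacking G (t.vertices n .cand) (edgeOpenPackingNumber G) ∧
      ∀ v ∈ t.vertices n .cand, k ≤ (v : ℕ) →
        ¬ HasPacking G ((t.vertices n .cand).erase v) (edgeOpenPackingNumber G))
    (N := n) (s := s.set .v n)
    ⟨by simpa using hbest, (hasPacking_univ_iff.2 le_rfl).mono hcand.ge,
      fun v _ h => absurd v.2 (not_lt.2 h)⟩ ?_
  · exact ⟨this.2.1, fun v hv => this.2.2 v hv (Nat.zero_le _)⟩
  · rintro k hk t ⟨h1, h2, h3⟩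
    have ht : (t.set .v k).vertices n .cand = t.vertices n .cand := rfl
    have e1 : (get .cand (var .v)).eval n (adjMatrix G) (t.set .v k) = t.arr .cand k := by
      simp [eval]
    have hmem : (⟨k, hk⟩ : Fin n) ∈ t.vertices n .cand ↔ t.arr .cand k ≠ 0 := State.mem_vertices
    have hsplit : ∀ v : Fin n, k ≤ (v : ℕ) → v = ⟨k, hk⟩ ∨ k + 1 ≤ (v : ℕ) := fun v hv => by
      rw [Fin.ext_iff]
      simp only
      omega
    rw [run_when, e1]
    split_ifs with hz
    · refine ⟨by simpa using h1, h2, fun v hv hkv => ?_⟩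
      rcases hsplit v hkv with rfl | h
      · exact absurd hz (hmem.1 hv)
      · exact h3 v hv h
    · rw [run_seq, run_seq, run_seq]
      set r₁ := copyCand.run n (adjMatrix G) (t.set .v k) with hr₁
      have hv1 : r₁.var .v = k := by
        rw [hr₁, copyCand, run_var_of_not_writes (by simp [Writes])]
        simp
      have hb1 : r₁.var .best = edgeOpenPackingNumber G := by
        rw [hr₁, copyCand, run_var_of_not_writes (by simp [Writes])]
        simpa using h1
      have hc1 : r₁.arr .cand = t.arr .cand := by
        rw [hr₁, copyCand, run_arr_of_not_puts (by simp [Puts])]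
        rfl
      have ha1 : r₁.vertices n .alive = t.vertices n .cand := copyCand_run
      set r₂ := (put .alive (var .v) (num 0)).run n (adjMatrix G) r₁ with hr₂
      have ha2 : r₂.vertices n .alive = (t.vertices n .cand).erase ⟨k, hk⟩ := by
        rw [← ha1, ← vertices_put_zero, hr₂, run_put, eval, eval, hv1]
      have hc2 : r₂.arr .cand = t.arr .cand := by
        rw [hr₂, run_arr_of_not_puts (by simp [Puts]), hc1]
      set r₃ := solve.run n (adjMatrix G) r₂ with hr₃
      have hc3 : r₃.arr .cand = t.arr .cand := (solve_run_arr (by simp) _).trans hc2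
      have hv3 : r₃.var .v = k := (solve_run_var (by simp) _).trans hv1
      have hb3 : r₃.var .best = edgeOpenPackingNumber G := (solve_run_var (by simp) _).trans hb1
      have hw3 : r₃.vertices n .cand = t.vertices n .cand := vertices_congr hc3
      have hacc : ∀ m, m ≤ r₃.var .acc ↔ HasPacking G ((t.vertices n .cand).erase ⟨k, hk⟩) m :=
        fun m => by rw [hr₃, solve_run hG, ha2]
      -- The optimum on a subset is at most the overall one, so `acc` differs from `best` only by
      -- being smaller.
      have hle : r₃.var .acc ≤ edgeOpenPackingNumber G :=
        hasPacking_univ_iff.1 (((hacc _).1 le_rfl).mono (Finset.subset_univ _))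
      have hcond : (Exp.not (.ne (var .acc) (var .best))).eval n (adjMatrix G) r₃ = 0 ↔
          ¬ HasPacking G ((t.vertices n .cand).erase ⟨k, hk⟩) (edgeOpenPackingNumber G) := by
        rw [eval_not, ne_eq, eval_ne, eval, eval, hb3, ← hacc]
        omega
      rw [run_when]
      split_ifs with h4 <;> rw [hcond] at h4
      · refine ⟨hb3, hw3 ▸ h2, fun v hv hkv => ?_⟩
        rw [hw3] at hv ⊢
        rcases hsplit v hkv with rfl | h
        · exact h4
        · exact h3 v hv h
      · rw [not_not] at h4
        have h5 : ((put .cand (var .v) (num 0)).run n (adjMatrix G) r₃).vertices n .cand =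
            (t.vertices n .cand).erase ⟨k, hk⟩ := by
          rw [← hw3, ← vertices_put_zero, run_put, eval, eval, hv3]
        rw [h5]
        refine ⟨hb3, h4, fun v hv hkv hpack => ?_⟩
        rw [Finset.mem_erase] at hv
        exact h3 v hv.2 ((hsplit v hkv).resolve_left hv.1)
          (hpack.mono (Finset.erase_subset_erase _ (Finset.erase_subset _ _)))

/-! ### Listing the edges, and the correctness of the output. -/

/-- The list `L` of pairs is stored in the arrays `fst` and `snd`. -/
def Stores (s : State) (L : List (Fin n × Fin n)) : Prop :=
  s.var .count = L.length ∧ ∀ k (h : k < L.length),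
    s.arr .fst k = (L[k].1 : ℕ) ∧ s.arr .snd k = (L[k].2 : ℕ)

theorem Stores.append {L : List (Fin n × Fin n)} (h : Stores s L) {i j : Fin n}
    (hi : s.var .i = i) (hj : s.var .j = j) :
    Stores ((put .fst (var .count) (var .i) ;; put .snd (var .count) (var .j) ;;
        assign .count (.add (var .count) (num 1))).run n (adjMatrix G) s) (L ++ [(i, j)]) := by
  obtain ⟨h1, h2⟩ := h
  refine ⟨by simp [eval, h1], fun k hk => ?_⟩
  rw [List.length_append, List.length_singleton] at hk
  by_cases hkL : k = L.length
  · subst hkL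
    simp [eval, h1, hi, hj]
  · have hk' : k < L.length := by omega
    rw [List.getElem_append_left hk']
    simpa [eval, h1, hkL] using h2 k hk'

theorem listEdges_run :
    ∃ L : List (Fin n × Fin n), L.Nodup ∧ (∀ p, p ∈ L ↔ p.1 ∈ s.vertices n .cand ∧
      p.2 ∈ s.vertices n .cand ∧ G.Adj p.1 p.2 ∧ p.1 < p.2) ∧
      Stores (listEdges.run n (adjMatrix G) s) L := by
  rw [listEdges, run_seq, run]
  let S : Fin n × Fin n → Prop := fun p => p.1 ∈ s.vertices n .cand ∧
      p.2 ∈ s.vertices n .cand ∧ G.Adj p.1 p.2 ∧ p.1 < p.2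
  have := countdown_induction
    (f := fun k t => (loop .j (
      when (.and (get .cand (var .i)) (.and (get .cand (var .j))
          (.and (adj (var .i) (var .j)) (.sub (var .j) (var .i)))))
        (put .fst (var .count) (var .i) ;; put .snd (var .count) (var .j) ;;
          assign .count (.add (var .count) (num 1))))).run n (adjMatrix G) (t.set .i k))
    (P := fun k (t : State) => t.arr .cand = s.arr .cand ∧ ∃ L : List (Fin n × Fin n), L.Nodup ∧
      (∀ p, p ∈ L ↔ S p ∧ k ≤ (p.1 : ℕ)) ∧ Stores t L)
    (N := n) (s := (s.set .count 0).set .i n)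
    ⟨rfl, [], List.nodup_nil, fun p => by simp, by simp, by simp⟩ ?_
  · obtain ⟨-, L, h1, h2, h3⟩ := this
    exact ⟨L, h1, fun p => (h2 p).trans (by simp [S]), h3⟩
  · rintro i hi t ⟨ht, L, h1, h2, h3⟩
    rw [run]
    -- Both loops count down: the list covers all rows after `i`, and row `i` from column `k` on.
    have := countdown_induction
      (f := fun k t => (
        when (.and (get .cand (var .i)) (.and (get .cand (var .j))
            (.and (adj (var .i) (var .j)) (.sub (var .j) (var .i)))))
          (put .fst (var .count) (var .i) ;; put .snd (var .count) (var .j) ;;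
            assign .count (.add (var .count) (num 1)))).run n (adjMatrix G) (t.set .j k))
      (P := fun k (t : State) => t.arr .cand = s.arr .cand ∧ t.var .i = i ∧
        ∃ L : List (Fin n × Fin n), L.Nodup ∧
        (∀ p, p ∈ L ↔ S p ∧ (i + 1 ≤ (p.1 : ℕ) ∨ (p.1 : ℕ) = i ∧ k ≤ (p.2 : ℕ))) ∧ Stores t L)
      (N := n) (s := (t.set .i i).set .j n)
      ⟨ht, by simp, L, h1, fun p => by simp [h2 p], by simpa using h3.1, h3.2⟩ ?_
    · obtain ⟨h1, -, L, h2, h3, h4⟩ := this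
      refine ⟨h1, L, h2, fun p => (h3 p).trans (and_congr_right fun _ => ?_), h4⟩
      omega
    · rintro j hj r ⟨r1, r2, L, h1, h2, h3⟩
      have e1 : (r.set .j j).var .i = (⟨i, hi⟩ : Fin n) := by simpa using r2
      have e2 : (r.set .j j).var .j = (⟨j, hj⟩ : Fin n) := by simp
      have h3' : Stores (r.set .j j) L := ⟨by simpa using h3.1, h3.2⟩
      classical
      have hcond : (Exp.and (get .cand (var .i)) (.and (get .cand (var .j))
          (.and (adj (var .i) (var .j)) (.sub (var .j) (var .i))))).eval n (adjMatrix G)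
            (r.set .j j) = 0 ↔ ¬ S (⟨i, hi⟩, ⟨j, hj⟩) := by
        simp only [ne_eq, eval_and, eval_adj e1 e2, S, State.mem_vertices]
        simp [eval, r1, r2, Nat.sub_eq_zero_iff_le]
      rw [run_when]
      split_ifs with h4 <;> rw [hcond] at h4
      · refine ⟨r1, e1, L, h1, fun p => (h2 p).trans (and_congr_right fun hp => ?_), h3'⟩
        have : ¬ ((p.1 : ℕ) = i ∧ (p.2 : ℕ) = j) := by
          rintro ⟨rfl, rfl⟩
          exact h4 hp
        omega
      · rw [not_not] at h4
        refine ⟨?_, ?_, L ++ [(⟨i, hi⟩, ⟨j, hj⟩)], ?_, fun p => ?_, h3'.append e1 e2⟩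
        · rw [run_arr_of_not_puts (by simp [Puts])]
          exact r1
        · rw [run_var_of_not_writes (by simp [Writes])]
          exact e1
        · rw [List.nodup_append]
          refine ⟨h1, by simp, ?_⟩
          rintro p hp q hq rfl
          rw [List.mem_singleton] at hq
          rw [h2, hq] at hp
          simp only at hp
          omega
        · rw [List.mem_append, h2, List.mem_singleton]
          constructor
          · rintro (⟨hp, h⟩ | rfl)
            · exact ⟨hp, by omega⟩
            · exact ⟨h4, by simp⟩
          · rintro ⟨hp, h⟩
            by_cases hpe : (p.1 : ℕ) = i ∧ (p.2 : ℕ) = j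
            · exact Or.inr (Prod.ext (Fin.ext hpe.1) (Fin.ext hpe.2))
            · exact Or.inl ⟨hp, by omega⟩

/-- The surviving candidates are critical, so the edges among them form a maximum packing; listing
only pairs with the smaller endpoint first excludes repetitions. The bound by `n` is needed because
just `n` entries of each array are put out. -/
theorem algorithm_run (hG : IsBlockGraph G) (s : State) :
    ∃ L : List (Fin n × Fin n), (L.map fun e => s(e.1, e.2)).Nodup ∧
      IsEdgeOpenPacking G {e | e ∈ L.map fun e => s(e.1, e.2)} ∧
      L.length = edgeOpenPackingNumber G ∧ L.length ≤ n ∧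
      Stores (algorithm.run n (adjMatrix G) s) L := by
  obtain ⟨h1, h2⟩ := prepare_run (s := s) hG
  obtain ⟨h3, h4⟩ := prune_run hG h1 h2
  obtain ⟨L, h5, h6, h7⟩ := listEdges_run (G := G)
    (s := prune.run n (adjMatrix G) (prepare.run n (adjMatrix G) s))
  obtain ⟨D, h8, h9, h10⟩ := h3.exists_of_critical h4
  have hnd : (L.map fun e => s(e.1, e.2)).Nodup := by
    refine List.Nodup.map_on ?_ h5
    rintro ⟨a, b⟩ hp ⟨c, d⟩ hq h
    have hab := ((h6 _).1 hp).2.2.2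
    have hcd := ((h6 _).1 hq).2.2.2
    rcases Sym2.eq_iff.1 h with ⟨h, h'⟩ | ⟨h, h'⟩
    · exact Prod.ext h h'
    · simp only at hab hcd h h'
      subst h h'
      exact absurd hab hcd.not_gt
  have hmem : ∀ e, e ∈ L.map (fun e => s(e.1, e.2)) ↔ e ∈ D := by
    intro e
    rw [h10, List.mem_map]
    constructor
    · rintro ⟨p, hp, rfl⟩
      obtain ⟨ha, hb, hab, -⟩ := (h6 p).1 hp
      refine ⟨hab, fun v hv => ?_⟩
      rcases Sym2.mem_iff.1 hv with rfl | rfl <;> assumption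
    · induction e using Sym2.ind with
      | _ a b =>
        rintro ⟨hab, hW⟩
        have ha := hW a (Sym2.mem_mk_left _ _)
        have hb := hW b (Sym2.mem_mk_right _ _)
        have hab' : G.Adj a b := hab
        rcases lt_or_gt_of_ne hab'.ne with h | h
        · exact ⟨(a, b), (h6 _).2 ⟨ha, hb, hab', h⟩, rfl⟩
        · exact ⟨(b, a), (h6 _).2 ⟨hb, ha, hab'.symm, h⟩, Sym2.eq_swap⟩
  have hlen : L.length = edgeOpenPackingNumber G := by
    rw [← h9, ← List.length_map (fun e => s(e.1, e.2)), ← List.toFinset_card_of_nodup hnd]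
    congr 1
    ext e
    rw [List.mem_toFinset, hmem]
  refine ⟨L, hnd, ?_, hlen, ?_, h7⟩
  · rwa [show {e | e ∈ L.map fun e => s(e.1, e.2)} = (D : Set (Sym2 (Fin n))) from Set.ext hmem]
  · rw [hlen]
    exact h3.le_card.trans ((Finset.card_le_univ _).trans (by simp))

theorem getElem_flatMap_pair {L : List (Fin n × Fin n)} {m : ℕ → ℕ}
    (h : ∀ k (hk : k < L.length), m (2 * k) = (L[k].1 : ℕ) ∧ m (2 * k + 1) = (L[k].2 : ℕ)) (k : ℕ)
    (hk : k < (L.flatMap fun e => [(e.1 : ℕ), (e.2 : ℕ)]).length) :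
    m k = (L.flatMap fun e => [(e.1 : ℕ), (e.2 : ℕ)])[k] := by
  induction L generalizing m k with
  | nil => simp at hk
  | cons e L ih =>
    match k with
    | 0 => exact (h 0 (by simp)).1
    | 1 => exact (h 0 (by simp)).2
    | k + 2 =>
      exact ih (m := fun k => m (k + 2)) (fun k hk => h (k + 1) (Nat.succ_lt_succ hk)) k
        (by simpa using hk)

end Imp

theorem mainTheorem2 :
    ∃ (p : RAM.Program) (T : Polynomial ℕ),
      ∀ (n : ℕ) (G : SimpleGraph (Fin n)), EOP.IsBlockGraph G →
        ∃ (t : ℕ) (c : RAM.Config), t ≤ T.eval n ∧ RAM.HaltsIn p t (RAM.input G) c ∧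
          ∃ L : List (Fin n × Fin n),
            (L.map fun e => s(e.1, e.2)).Nodup ∧
            EOP.IsEdgeOpenPacking G {e | e ∈ L.map fun e => s(e.1, e.2)} ∧
            L.length = EOP.edgeOpenPackingNumber G ∧
            RAM.Outputs c (EOP.edgeOpenPackingNumber G ::
              L.flatMap fun e => [(e.1 : ℕ), (e.2 : ℕ)]) := by
  obtain ⟨p, T, h⟩ := Imp.Stmt.exists_program Imp.algorithm_loopsOk
  refine ⟨p, T, fun n G hG => ?_⟩
  obtain ⟨t, c, ht, hh, h0, hout⟩ := h n G
  obtain ⟨L, h1, h2, h3, h4, h5, h6⟩ := Imp.algorithm_run hG Imp.State.zero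
  refine ⟨t, c, ht, hh, L, h1, h2, h3, fun k hk => ?_⟩
  match k with
  | 0 => exact h0.trans (h5.trans h3)
  | k + 1 =>
    -- Cell `0` holds the size, hence the shift by one; the bound `h4` on the length ensures that
    -- each pair has been put out.
    refine Imp.getElem_flatMap_pair (m := fun k => c.mem (k + 1)) (fun k hk => ?_) k _
    obtain ⟨h7, h8⟩ := hout k (hk.trans_le h4)
    obtain ⟨h9, h10⟩ := h6 k hk
    exact ⟨by rw [← h9, ← h7, Nat.add_comm], by rw [← h10, ← h8]; congr 1; omega⟩
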